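/- Let $s \ge 2$, let $\pi = (\pi_1,\dots,\pi_s)$ be a probability vector, and let $M$ be a symmetric $s \times s$ matrix with non-negative real entries such that $d := \sum_j M_{ij}\pi_j$ does not depend on $i$. Let $\mathbb{P}_n$ be the law of the following random graph on $n$ vertices: give the vertices independent labels $\sigma_v$ with distribution $\pi$ and then, given the labels, join each pair $\{u,v\}$ independently with probability $\min(1, M_{\sigma_u\sigma_v}/n)$ (which is $M_{\sigma_u\sigma_v}/n$ for all large $n$). Let $\mathbb{Q}_n = \mathcal{G}(n, \min(1, d/n))$ be the Erdős–Rényi law, in which each pair is joined independently with probability $\min(1,d/n)$. When $d > 0$, let $T = \frac1d \operatorname{diag}(\pi) M$, and let $\lambda_1, \dots, \lambda_s$ be the eigenvalues of $T$ (all real), listed with multiplicity in order of decreasing absolute value. For a graph $G$ let $X_k(G)$ be the number of $k$-cycles in $G$. Theorem. Suppose that $d > 0$ and $d\lambda_2^2 > 1$. Then $\mathbb{P}_n$ and $\mathbb{Q}_n$ are asymptotically orthogonal: there are events $\Omega_n$ (sets of graphs on $n$ vertices) with $\mathbb{P}_n(\Omega_n) \to 1$ and $\mathbb{Q}_n(\Omega_n)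 \to 0$. Moreover, the events can be taken to be thresholds on cycle counts: there are integers $k_n \to \infty$ and real numbers $t_n$ such that $$\mathbb{P}_n(X_{k_n} \ge t_n) \to 1 \quad\text{and}\quad \mathbb{Q}_n(X_{k_n} \ge t_n) \to 0 .$$ For fixed $k$, the thresholds can be located as follows: for every $\varepsilon > 0$ there are $C > 0$ and $k_0$ such that for every even $k \ge k_0$, with $$t = \frac{1}{2k} d^k \operatorname{tr}(T^k) - C k^{-1/2} d^{k/2},$$ we have $\mathbb{P}_n(X_k \ge t) \ge 1 - \varepsilon$ and $\mathbb{Q}_n(X_k \ge t) \le \varepsilon$ for all sufficiently large $n$. -/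

import Mathlib

open Filter Topology MeasureTheory

namespace BlockModel

noncomputable section

/-- The probability `min(1, x / n)` of an edge, for `x ≥ 0`, as a point of the unit interval;
it equals `x / n` as soon as `n ≥ x` and `n ≥ 1`. -/
def edgeProb (n : ℕ) (x : ℝ) : unitInterval :=
  Set.projIcc (0 : ℝ) 1 zero_le_one (x / n)

open Classical in
/-- The joint density of the block model at a graph `G` on the vertex set `Fin n` and a
labelling `σ` of the vertices by `Fin s`: the labels are i.i.d. with law `π` and, given the labels,
the pairs `u < v` are joined independently with probability `M (σ u) (σ v) / n`. -/
def density {s : ℕ} (n : ℕ) (M : Matrix (Fin s) (Fin s) ℝ) (π : Fin s → ℝ)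
    (G : SimpleGraph (Fin n)) (σ : Fin n → Fin s) : ℝ :=
  (∏ v, π (σ v)) *
    ∏ e : Fin n × Fin n with e.1 < e.2,
      if G.Adj e.1 e.2 then (edgeProb n (M (σ e.1) (σ e.2)) : ℝ)
      else 1 - (edgeProb n (M (σ e.1) (σ e.2)) : ℝ)

open Classical in
/-- The law of the random graph of the block model with `n` vertices, edge matrix `M` and
label distribution `π`: the graph marginal of the joint law of graph and labels. -/
def blockModel {s : ℕ} (n : ℕ) (M : Matrix (Fin s) (Fin s) ℝ) (π : Fin s → ℝ) :
    Measure (SimpleGraph (Fin n)) :=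
  ∑ G : SimpleGraph (Fin n), ∑ σ : Fin n → Fin s,
    ENNReal.ofReal (density n M π G σ) • Measure.dirac G

/-- The law of the Erdős–Rényi graph on `Fin n` with edge probability `d / n`. -/
def erdosRenyi (n : ℕ) (d : ℝ) : Measure (SimpleGraph (Fin n)) :=
  SimpleGraph.binomialRandom (Fin n) (edgeProb n d)

/-- The matrix `T = (1 / d) diag(π) M`. -/
def transitionMatrix {s : ℕ} (M : Matrix (Fin s) (Fin s) ℝ) (π : Fin s → ℝ) (d : ℝ) :
    Matrix (Fin s) (Fin s) ℝ :=
  (1 / d) • (Matrix.diagonal π * M)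

/-- `lam` lists the eigenvalues of `T`, with algebraic multiplicity, in order of decreasing
absolute value. -/
def IsEigenvalueList {s : ℕ} (T : Matrix (Fin s) (Fin s) ℝ) (lam : Fin s → ℝ) : Prop :=
  T.charpoly = ∏ i, (Polynomial.X - Polynomial.C (lam i)) ∧ Antitone fun i => |lam i|

/-- The matrix `T` of a block model has all its eigenvalues real, so that they can be listed. -/
theorem exists_isEigenvalueList {s : ℕ} (M : Matrix (Fin s) (Fin s) ℝ) (π : Fin s → ℝ) (d : ℝ)
    (hM : M.IsSymm) (hπ : ∀ i, 0 ≤ π i) :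
    ∃ lam, IsEigenvalueList (transitionMatrix M π d) lam := by
  set D : Matrix (Fin s) (Fin s) ℝ := Matrix.diagonal fun i => √(π i) with hD
  have hDD : D * D = Matrix.diagonal π := by
    rw [hD, Matrix.diagonal_mul_diagonal]
    congr 1
    funext i
    exact Real.mul_self_sqrt (hπ i)
  have hH : ((1 / d) • (D * M * D)).IsHermitian := by
    unfold Matrix.IsHermitian
    rw [Matrix.conjTranspose_eq_transpose_of_trivial]
    simp only [Matrix.transpose_smul, Matrix.transpose_mul, hM.eq, hD,
      Matrix.diagonal_transpose, Matrix.mul_assoc]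
  have hc : (transitionMatrix M π d).charpoly = ((1 / d) • (D * M * D)).charpoly := by
    have h1 : transitionMatrix M π d = D * ((1 / d) • (D * M)) := by
      rw [transitionMatrix, ← hDD, Matrix.mul_smul, Matrix.mul_assoc]
    rw [h1, Matrix.charpoly_mul_comm, Matrix.smul_mul]
  let e : Equiv.Perm (Fin s) := Tuple.sort fun i => -|hH.eigenvalues i|
  refine ⟨hH.eigenvalues ∘ e, ?_, ?_⟩
  · rw [hc, hH.charpoly_eq]
    exact (Equiv.prod_comp e fun i =>
      Polynomial.X - Polynomial.C (hH.eigenvalues i)).symm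
  · intro i j hij
    have := Tuple.monotone_sort (fun i => -|hH.eigenvalues i|) hij
    simpa [e] using this

/-- The number of `k`-cycles in `G`, that is, of subgraphs of `G` isomorphic to the cycle on `k`
vertices. -/
def cycleCount (k : ℕ) {n : ℕ} (G : SimpleGraph (Fin n)) : ℕ :=
  G.copyCount (SimpleGraph.cycleGraph k)

/-- Two sequences of laws of random graphs are asymptotically orthogonal: some sequence of events
has probability tending to one under the first and to zero under the second. -/
def AsymptoticallyOrthogonal (P Q : ∀ n : ℕ, Measure (SimpleGraph (Fin n))) : Prop :=
  ∃ Ω : ∀ n : ℕ, Set (SimpleGraph (Fin n)),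
    Tendsto (fun n => (P n).real (Ω n)) atTop (𝓝 1) ∧
      Tendsto (fun n => (Q n).real (Ω n)) atTop (𝓝 0)

/-- The threshold `d ^ k tr(T ^ k) / (2 k) - C k ^ (-1/2) d ^ (k/2)`. -/
def cycleThreshold {s : ℕ} (T : Matrix (Fin s) (Fin s) ℝ) (d C : ℝ) (k : ℕ) : ℝ :=
  d ^ k * (T ^ k).trace / (2 * k) - C * √(d ^ k / k)

end

end BlockModel

namespace BlockModel

/-! The proof is a second moment argument for the number $X_k$ of $k$-cycles, with $k \ge 3$ fixed
and $n \to \infty$. Counting labelled cycles (each cycle has $2k$ labellings), the mean of $X_k$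
under the block model tends to $\mu = \operatorname{tr}((\operatorname{diag}(\pi)M)^k)/(2k) =
d^k\operatorname{tr}(T^k)/(2k)$, because averaging the edge probabilities around a cycle over the
labels gives a trace. In the second moment, vertex-disjoint pairs of cycles are exactly
uncorrelated, coinciding pairs contribute the mean, and all other pairs contribute $O(1/n)$, since
their union has more edges than vertices (`card_range_lt_card_cycleEdges_union`). So the mean square
deviation from $\mu$ is asymptotically at most $\mu$ (`eventually_expect_cycleCount_sub_sq_le`).

The Erdős–Rényi law is the block model with constant matrix $d$, so the same computation gives it
mean $d^k/(2k)$. As $T$ is non-negative with column sums 1, $\operatorname{tr}(T^k) \le s$, and both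
standard deviations are of order $\sqrt{d^k/k}$. For even $k$ the means differ by at least
$d^k\lambda_2^k/(2k)$, which exceeds this scale by a factor of order $(d\lambda_2^2)^{k/2}/\sqrt{k}
\to \infty$. Chebyshev's inequality separates the two laws for each large even $k$
(`exists_threshold`), and letting $k$ grow slowly with $n$ gives the limits. -/

/-! ### Independent edges, and expectations under the two laws. -/

open Classical in
/-- The weight of a graph whose pairs are joined independently, `e` with probability `p e`. -/
noncomputable def graphWeight {V : Type*} [Fintype V] (p : Sym2 V → ℝ) (G : SimpleGraph V) : ℝ :=
  ∏ e : Sym2 V with ¬ e.IsDiag, if e ∈ G.edgeSet then p e else 1 - p e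

theorem graphWeight_nonneg {V : Type*} [Fintype V] {p : Sym2 V → ℝ} (h0 : ∀ e, 0 ≤ p e)
    (h1 : ∀ e, p e ≤ 1) (G : SimpleGraph V) : 0 ≤ graphWeight p G := by
  classical
  refine Finset.prod_nonneg fun e _ => ?_
  split_ifs
  · exact h0 e
  · linarith [h1 e]

-- Expand $\prod_e (p_e + q_e)$ over the edge sets, where $q_e = 1 - p_e$ off `E` and $q_e = 0$ on
-- `E`: the edge sets that miss a member of `E` drop out.
open Classical in
theorem sum_graphWeight_of_subset {V : Type*} [Fintype V] [Fintype (SimpleGraph V)] (p : Sym2 V → ℝ) (E : Finset (Sym2 V))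
    (hE : ∀ e ∈ E, ¬ e.IsDiag) :
    ∑ G : SimpleGraph V, graphWeight p G * (if (E : Set (Sym2 V)) ⊆ G.edgeSet then 1 else 0) =
      ∏ e ∈ E, p e := by
  set N : Finset (Sym2 V) := Finset.univ.filter fun e => ¬ e.IsDiag with hN
  have hEN : E ⊆ N := fun e he => by simp [hN, hE e he]
  have key := Finset.prod_add p (fun e => if e ∈ E then 0 else 1 - p e) N
  have hl : ∏ e ∈ N, (p e + if e ∈ E then 0 else 1 - p e) = ∏ e ∈ E, p e := by
    rw [← Finset.prod_subset hEN (f := fun e => p e + if e ∈ E then 0 else 1 - p e)]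
    · exact Finset.prod_congr rfl fun e he => by simp [he]
    · intro e _ he; simp [he]
  rw [← hl, key]
  refine Finset.sum_bij' (fun G _ => G.edgeFinset) (fun t _ => SimpleGraph.fromEdgeSet (t : Set (Sym2 V)))
    ?_ ?_ ?_ ?_ ?_
  · intro G _
    rw [Finset.mem_powerset]
    intro e he
    simpa [hN] using G.not_isDiag_of_mem_edgeSet (SimpleGraph.mem_edgeFinset.1 he)
  · intro t _; simp
  · intro G _; simp
  · intro t ht
    ext e
    simp only [SimpleGraph.mem_edgeFinset, SimpleGraph.edgeSet_fromEdgeSet]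
    rw [Finset.mem_powerset] at ht
    constructor
    · intro h; exact h.1
    · intro h; exact ⟨h, by simpa [hN] using ht h⟩
  · intro G _
    have hsub : G.edgeFinset ⊆ N := by
      intro e he
      simpa [hN] using G.not_isDiag_of_mem_edgeSet (SimpleGraph.mem_edgeFinset.1 he)
    have h1 : graphWeight p G = (∏ e ∈ G.edgeFinset, p e) * ∏ e ∈ N \ G.edgeFinset, (1 - p e) := by
      unfold graphWeight
      rw [← hN, ← Finset.prod_sdiff hsub, mul_comm]
      congr 1
      · exact Finset.prod_congr rfl fun e he => by
          rw [if_pos (SimpleGraph.mem_edgeFinset.1 he)]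
      · exact Finset.prod_congr rfl fun e he => by
          rw [if_neg (fun h => (Finset.mem_sdiff.1 he).2 (SimpleGraph.mem_edgeFinset.2 h))]
    rw [h1, mul_assoc]
    congr 1
    split_ifs with h
    · rw [mul_one]
      refine Finset.prod_congr rfl fun e he => ?_
      rw [if_neg]
      intro h'
      exact (Finset.mem_sdiff.1 he).2 (SimpleGraph.mem_edgeFinset.2 (h h'))
    · rw [mul_zero]
      obtain ⟨e, he, heG⟩ := Set.not_subset.1 h
      refine (Finset.prod_eq_zero (i := e) ?_ ?_).symm
      · exact Finset.mem_sdiff.2 ⟨hEN he, fun h => heG (SimpleGraph.mem_edgeFinset.1 h)⟩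
      · simp [Finset.mem_coe.1 he]

theorem edgeProb_nonneg (n : ℕ) (x : ℝ) : 0 ≤ (edgeProb n x : ℝ) := (edgeProb n x).2.1

theorem edgeProb_le_one (n : ℕ) (x : ℝ) : (edgeProb n x : ℝ) ≤ 1 := (edgeProb n x).2.2

theorem coe_edgeProb {n : ℕ} {x : ℝ} (hx : 0 ≤ x) : (edgeProb n x : ℝ) = min 1 (x / n) := by
  have : 0 ≤ x / n := by positivity
  rw [edgeProb, Set.coe_projIcc]
  exact max_eq_right (le_min zero_le_one this)

/-- Given the labels, the probability that a pair of vertices is joined. -/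
noncomputable def pairProb {s : ℕ} (n : ℕ) (M : Matrix (Fin s) (Fin s) ℝ) (σ : Fin n → Fin s)
    (e : Sym2 (Fin n)) : ℝ :=
  edgeProb n (M (σ e.inf) (σ e.sup))

/-- `pairProb` reads the two labels in increasing order of the vertices; symmetry of `M` makes that
order irrelevant. -/
theorem pairProb_mk {s n : ℕ} {M : Matrix (Fin s) (Fin s) ℝ} (hM : M.IsSymm) (σ : Fin n → Fin s)
    (a b : Fin n) : pairProb n M σ s(a, b) = edgeProb n (M (σ a) (σ b)) := by
  rcases le_total a b with h | h
  · simp [pairProb, h]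
  · simp only [pairProb, Sym2.inf_mk, Sym2.sup_mk, inf_eq_right.2 h, sup_eq_left.2 h]
    rw [hM.apply]

theorem density_eq {s : ℕ} (n : ℕ) (M : Matrix (Fin s) (Fin s) ℝ) (π : Fin s → ℝ)
    (G : SimpleGraph (Fin n)) (σ : Fin n → Fin s) :
    density n M π G σ = (∏ v, π (σ v)) * graphWeight (pairProb n M σ) G := by
  classical
  rw [density, graphWeight]
  congr 1
  refine Finset.prod_bij' (fun e _ => s(e.1, e.2)) (fun e _ => (e.inf, e.sup)) ?_ ?_ ?_ ?_ ?_
  · intro e he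
    simpa using (Finset.mem_filter.1 he).2.ne
  · intro e he
    induction e with | h a b => simpa [eq_comm] using he
  · intro e he
    simp [(Finset.mem_filter.1 he).2.le]
  · intro e he
    induction e with | h a b =>
      rcases le_total a b with h | h <;> simp [h, Sym2.eq_swap]
  · intro e he
    simp [pairProb, (Finset.mem_filter.1 he).2.le]

theorem density_nonneg {s n : ℕ} (M : Matrix (Fin s) (Fin s) ℝ) {π : Fin s → ℝ}
    (hπ : ∀ i, 0 ≤ π i) (G : SimpleGraph (Fin n)) (σ : Fin n → Fin s) :
    0 ≤ density n M π G σ := by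
  rw [density_eq]
  exact mul_nonneg (Finset.prod_nonneg fun v _ => hπ _)
    (graphWeight_nonneg (fun _ => edgeProb_nonneg _ _) (fun _ => edgeProb_le_one _ _) G)

open Classical in
/-- The expectation of a function of the graph in the block model. -/
noncomputable def expect {s : ℕ} (n : ℕ) (M : Matrix (Fin s) (Fin s) ℝ) (π : Fin s → ℝ)
    (F : SimpleGraph (Fin n) → ℝ) : ℝ :=
  ∑ G : SimpleGraph (Fin n), (∑ σ : Fin n → Fin s, density n M π G σ) * F G

theorem expect_mono {s n : ℕ} (M : Matrix (Fin s) (Fin s) ℝ) {π : Fin s → ℝ}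
    (hπ : ∀ i, 0 ≤ π i) {F F' : SimpleGraph (Fin n) → ℝ} (h : ∀ G, F G ≤ F' G) :
    expect n M π F ≤ expect n M π F' :=
  Finset.sum_le_sum fun G _ => mul_le_mul_of_nonneg_left (h G)
    (Finset.sum_nonneg fun σ _ => density_nonneg M hπ G σ)

theorem expect_add {s n : ℕ} (M : Matrix (Fin s) (Fin s) ℝ) (π : Fin s → ℝ)
    (F F' : SimpleGraph (Fin n) → ℝ) :
    expect n M π (fun G => F G + F' G) = expect n M π F + expect n M π F' := by
  simp only [expect, mul_add, Finset.sum_add_distrib]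

theorem expect_const_mul {s n : ℕ} (M : Matrix (Fin s) (Fin s) ℝ) (π : Fin s → ℝ) (c : ℝ)
    (F : SimpleGraph (Fin n) → ℝ) :
    expect n M π (fun G => c * F G) = c * expect n M π F := by
  simp only [expect, Finset.mul_sum]
  exact Finset.sum_congr rfl fun G _ => by ring

theorem expect_sum {s n : ℕ} (M : Matrix (Fin s) (Fin s) ℝ) (π : Fin s → ℝ) {ι : Type*}
    (t : Finset ι) (F : ι → SimpleGraph (Fin n) → ℝ) :
    expect n M π (fun G => ∑ i ∈ t, F i G) = ∑ i ∈ t, expect n M π (F i) := by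
  simp only [expect, Finset.mul_sum]
  exact Finset.sum_comm

open Classical in
theorem expect_indicator_subset {s : ℕ} (n : ℕ) (M : Matrix (Fin s) (Fin s) ℝ) (π : Fin s → ℝ)
    (E : Finset (Sym2 (Fin n))) (hE : ∀ e ∈ E, ¬ e.IsDiag) :
    expect n M π (fun G => if (E : Set (Sym2 (Fin n))) ⊆ G.edgeSet then 1 else 0) =
      ∑ σ : Fin n → Fin s, (∏ v, π (σ v)) * ∏ e ∈ E, pairProb n M σ e := by
  unfold expect
  simp only [Finset.sum_mul, density_eq]
  rw [Finset.sum_comm]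
  refine Finset.sum_congr rfl fun σ _ => ?_
  rw [← sum_graphWeight_of_subset _ E hE, Finset.mul_sum]
  exact Finset.sum_congr rfl fun G _ => mul_assoc _ _ _

theorem sum_prod_eq_one {s : ℕ} {V : Type*} [Fintype V] [DecidableEq V] {π : Fin s → ℝ}
    (hπ : π ∈ stdSimplex ℝ (Fin s)) : ∑ σ : V → Fin s, ∏ v, π (σ v) = 1 := by
  have h := Finset.prod_univ_sum (fun _ : V => (Finset.univ : Finset (Fin s))) (fun _ j => π j)
  rw [Fintype.piFinset_univ] at h
  rw [← h]
  simp [hπ.2]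

theorem expect_one {s : ℕ} (n : ℕ) (M : Matrix (Fin s) (Fin s) ℝ) {π : Fin s → ℝ}
    (hπ : π ∈ stdSimplex ℝ (Fin s)) : expect n M π (fun _ => 1) = 1 := by
  have h := expect_indicator_subset n M π ∅ (by simp)
  simpa [sum_prod_eq_one hπ] using h

instance {V : Type*} [Countable V] : MeasurableSingletonClass (SimpleGraph V) where
  measurableSet_singleton G := by
    have h : MeasurableSet (SimpleGraph.edgeSet ⁻¹' {G.edgeSet}) :=
      SimpleGraph.measurable_edgeSet (measurableSet_singleton _)
    convert! h using 1
    ext H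
    simp

open Classical in
theorem blockModel_real {s : ℕ} (n : ℕ) (M : Matrix (Fin s) (Fin s) ℝ) {π : Fin s → ℝ}
    (hπ : ∀ i, 0 ≤ π i) (S : Set (SimpleGraph (Fin n))) :
    (blockModel n M π).real S = expect n M π (fun G => if G ∈ S then 1 else 0) := by
  have hS : MeasurableSet S := S.toFinite.measurableSet
  rw [Measure.real, blockModel]
  simp only [Measure.coe_finsetSum, Finset.sum_apply, Measure.smul_apply,
    Measure.dirac_apply' _ hS, smul_eq_mul]
  rw [ENNReal.toReal_sum]
  · refine Finset.sum_congr rfl fun G _ => ?_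
    rw [ENNReal.toReal_sum, Finset.sum_mul]
    · refine Finset.sum_congr rfl fun σ _ => ?_
      rw [ENNReal.toReal_mul, ENNReal.toReal_ofReal (density_nonneg M hπ G σ)]
      by_cases h : G ∈ S <;> simp [h]
    · intro σ _
      by_cases h : G ∈ S <;> simp [h]
  · intro G _
    refine ENNReal.sum_ne_top.2 fun σ _ => ?_
    by_cases h : G ∈ S <;> simp [h]

-- With a constant matrix the labels do not influence the edges and sum out, whatever `π` is. One
-- moment computation therefore serves both laws.
open Classical in
theorem erdosRenyi_real {s : ℕ} (n : ℕ) (d : ℝ) {π : Fin s → ℝ}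
    (hπ : π ∈ stdSimplex ℝ (Fin s)) (S : Set (SimpleGraph (Fin n))) :
    (erdosRenyi n d).real S =
      expect n (Matrix.of fun _ _ => d) π (fun G => if G ∈ S then 1 else 0) := by
  have hsing : ∀ G : SimpleGraph (Fin n), (erdosRenyi n d).real {G} =
      graphWeight (fun _ => (edgeProb n d : ℝ)) G := by
    intro G
    rw [erdosRenyi, Measure.real, SimpleGraph.binomialRandom_apply', Set.image_singleton,
      ← Measure.real, ProbabilityTheory.setBernoulli_real_singleton _ (by simp) (Set.toFinite _),
      graphWeight, Finset.prod_ite, Finset.prod_const, Finset.prod_const,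
      ← Set.ncard_coe_finset, ← Set.ncard_coe_finset]
    congr 3
    · ext e
      simpa using fun h => G.not_isDiag_of_mem_edgeSet h
    · ext e
      simp
  have : IsProbabilityMeasure (erdosRenyi n d) := by unfold erdosRenyi; infer_instance
  have h1 : (erdosRenyi n d).real S = ∑ G ∈ S.toFinset, (erdosRenyi n d).real {G} := by
    rw [sum_measureReal_singleton]; simp
  rw [h1, expect]
  simp only [mul_ite, mul_one, mul_zero]
  rw [← Finset.sum_filter]
  refine Finset.sum_congr (by ext; simp) fun G _ => ?_
  simp only [density_eq, hsing]
  rw [← one_mul (graphWeight _ G), ← sum_prod_eq_one (V := Fin n) hπ, Finset.sum_mul]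
  rfl

/-- Chebyshev's inequality for the block model. -/
theorem blockModel_expect_le_of_sq {s : ℕ} (n : ℕ) (M : Matrix (Fin s) (Fin s) ℝ) {π : Fin s → ℝ}
    (hπ : ∀ i, 0 ≤ π i) (X : SimpleGraph (Fin n) → ℝ) (μ a : ℝ) (ha : 0 < a)
    (p : SimpleGraph (Fin n) → Prop) [DecidablePred p] (hp : ∀ G, p G → a ≤ |X G - μ|) :
    expect n M π (fun G => if p G then 1 else 0) ≤
      expect n M π (fun G => (X G - μ) ^ 2) / a ^ 2 := by
  rw [le_div_iff₀ (by positivity), mul_comm, ← expect_const_mul]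
  refine expect_mono M hπ fun G => ?_
  split_ifs with h
  · rw [mul_one, ← sq_abs (X G - μ)]
    exact pow_le_pow_left₀ ha.le (hp G h) 2
  · simpa using sq_nonneg _

/-! ### Combinatorics of labelled cycles. -/

/-- The edges of the closed walk `f 0, f 1, …, f (k - 1), f 0`. -/
def cycleEdges {V : Type*} [DecidableEq V] {m : ℕ} (f : Fin (m + 3) → V) : Finset (Sym2 V) :=
  Finset.univ.image fun i => s(f i, f (i + 1))

/-- Length at least 3 enters here: two steps forward never return to the start, so the two
directions around a cycle differ. -/
theorem fin_one_add_one_ne_zero (m : ℕ) : (1 : Fin (m + 3)) + 1 ≠ 0 := by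
  intro h
  have := congrArg Fin.val h
  simp only [Fin.val_add, Fin.val_one, Fin.val_zero] at this
  rw [Nat.mod_eq_of_lt (by omega)] at this
  omega

theorem cycleEdges_mk_injective {V : Type*} {m : ℕ} {f : Fin (m + 3) → V}
    (hf : Function.Injective f) : Function.Injective fun i => s(f i, f (i + 1)) := by
  intro i j h
  rcases Sym2.eq_iff.1 h with ⟨h, _⟩ | ⟨h1, h2⟩
  · exact hf h
  · have h1 := hf h1
    have h2 := hf h2
    rw [h1, add_assoc] at h2
    exact absurd (add_eq_left.1 h2) (fin_one_add_one_ne_zero m)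

theorem card_cycleEdges {V : Type*} [DecidableEq V] {m : ℕ} {f : Fin (m + 3) → V} (hf : Function.Injective f) :
    (cycleEdges f).card = m + 3 := by
  rw [cycleEdges, Finset.card_image_of_injective _ (cycleEdges_mk_injective hf)]
  simp

theorem not_isDiag_of_mem_cycleEdges {V : Type*} [DecidableEq V] {m : ℕ} {f : Fin (m + 3) → V} (hf : Function.Injective f)
    {e : Sym2 V} (he : e ∈ cycleEdges f) : ¬ e.IsDiag := by
  obtain ⟨i, -, rfl⟩ := Finset.mem_image.1 he
  rw [Sym2.mk_isDiag_iff]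
  intro h
  simpa using hf h

theorem prod_cycleEdges {V : Type*} [DecidableEq V] {m : ℕ} {f : Fin (m + 3) → V} (hf : Function.Injective f)
    (p : Sym2 V → ℝ) : ∏ e ∈ cycleEdges f, p e = ∏ i, p s(f i, f (i + 1)) := by
  rw [cycleEdges, Finset.prod_image fun i _ j _ h => cycleEdges_mk_injective hf h]

theorem mem_range_of_mem_cycleEdges {V : Type*} [DecidableEq V] {m : ℕ} {f : Fin (m + 3) → V} {e : Sym2 V}
    (he : e ∈ cycleEdges f) {v : V} (hv : v ∈ e) : v ∈ Set.range f := by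
  obtain ⟨i, -, rfl⟩ := Finset.mem_image.1 he
  rcases Sym2.mem_iff.1 hv with rfl | rfl <;> exact Set.mem_range_self _

theorem disjoint_cycleEdges {V : Type*} [DecidableEq V] {m : ℕ} {f g : Fin (m + 3) → V}
    (h : Disjoint (Set.range f) (Set.range g)) : Disjoint (cycleEdges f) (cycleEdges g) := by
  rw [Finset.disjoint_left]
  intro e he he'
  induction e with | h a b =>
    exact Set.disjoint_left.1 h (mem_range_of_mem_cycleEdges he (Sym2.mem_mk_left a b))
      (mem_range_of_mem_cycleEdges he' (Sym2.mem_mk_left a b))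

/-- The rotations and reflections of a labelled cycle. -/
def cycleRelabel {V : Type*} {m : ℕ} (f : Fin (m + 3) → V) (x : Bool × Fin (m + 3)) : Fin (m + 3) → V :=
  fun i => f (if x.1 then x.2 + i else x.2 - i)

/-- The image of 0 determines the base point, and then the image of 1 determines the direction. -/
theorem cycleRelabel_injective {V : Type*} {m : ℕ} {f : Fin (m + 3) → V} (hf : Function.Injective f) :
    Function.Injective (cycleRelabel f) := by
  rintro ⟨b, a⟩ ⟨b', a'⟩ h
  have h0 := hf (congrFun h 0)
  have h1 := hf (congrFun h 1)
  have ha : a = a' := by simpa using h0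
  subst ha
  have key : a + 1 ≠ a - 1 := by
    intro h
    have h2 := congrArg (· - a + 1) h
    simp only [add_sub_cancel_left, sub_sub_cancel_left, neg_add_cancel] at h2
    exact fin_one_add_one_ne_zero m h2
  rcases b <;> rcases b' <;> simp [key, key.symm] at h1 ⊢

theorem injective_cycleRelabel {V : Type*} {m : ℕ} {f : Fin (m + 3) → V} (hf : Function.Injective f)
    (x : Bool × Fin (m + 3)) : Function.Injective (cycleRelabel f x) := by
  intro i j h
  have := hf h
  rcases x with ⟨_ | _, a⟩ <;> simpa using this

theorem cycleEdges_cycleRelabel {V : Type*} [DecidableEq V] {m : ℕ} (f : Fin (m + 3) → V) (x : Bool × Fin (m + 3)) :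
    cycleEdges (cycleRelabel f x) = cycleEdges f := by
  have key : ∀ (f : Fin (m + 3) → V) x, cycleEdges (cycleRelabel f x) ⊆ cycleEdges f := by
    rintro f ⟨b, a⟩ e he
    obtain ⟨i, -, rfl⟩ := Finset.mem_image.1 he
    rcases b
    · refine Finset.mem_image.2 ⟨a - (i + 1), Finset.mem_univ _, ?_⟩
      simp only [cycleRelabel, Bool.false_eq_true, if_false]
      rw [Sym2.eq_swap, sub_add_eq_sub_sub, sub_add_cancel]
    · refine Finset.mem_image.2 ⟨a + i, Finset.mem_univ _, ?_⟩
      simp only [cycleRelabel, if_true, add_assoc]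
  refine (key f x).antisymm ?_
  -- The inverse of a relabelling is a relabelling: a rotation is undone by the opposite rotation,
  -- and a reflection is its own inverse.
  have h : f = cycleRelabel (cycleRelabel f x) (x.1, if x.1 then -x.2 else x.2) := by
    funext i
    rcases x with ⟨_ | _, a⟩ <;> simp [cycleRelabel]
  conv_lhs => rw [h]
  exact key _ _

/-- Read through `f`, the labelling `g` becomes a walk `φ` on the cyclic group with steps $\pm 1$.
It cannot turn back, by injectivity, so it keeps the direction of its first step. -/
theorem exists_cycleRelabel_eq {V : Type*} [DecidableEq V] {m : ℕ} {f g : Fin (m + 3) → V}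
    (hf : Function.Injective f) (hg : Function.Injective g) (h : cycleEdges g ⊆ cycleEdges f) :
    ∃ x, cycleRelabel f x = g := by
  have hedge : ∀ i, ∃ j, s(f j, f (j + 1)) = s(g i, g (i + 1)) := by
    intro i
    obtain ⟨j, -, hj⟩ := Finset.mem_image.1 (h (Finset.mem_image_of_mem _ (Finset.mem_univ i)))
    exact ⟨j, hj⟩
  have hφ : ∀ i, ∃ j, f j = g i := by
    intro i
    obtain ⟨j, hj⟩ := hedge i
    rcases Sym2.eq_iff.1 hj with h | h
    · exact ⟨j, h.1⟩
    · exact ⟨j + 1, h.2⟩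
  choose φ hφ using hφ
  have hφi : Function.Injective φ := fun i j hij => hg (by rw [← hφ i, ← hφ j, hij])
  have hstep : ∀ i, φ (i + 1) = φ i + 1 ∨ φ i = φ (i + 1) + 1 := by
    intro i
    obtain ⟨j, hj⟩ := hedge i
    rw [← hφ i, ← hφ (i + 1)] at hj
    rcases Sym2.eq_iff.1 hj with ⟨h1, h2⟩ | ⟨h1, h2⟩
    · exact Or.inl ((hf h2).symm.trans (congrArg (· + 1) (hf h1)))
    · exact Or.inr ((hf h2).symm.trans (congrArg (· + 1) (hf h1)))
  have hback : ∀ i, φ (i + 1 + 1) ≠ φ i := by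
    intro i h
    have h := hφi h
    rw [add_assoc] at h
    exact fin_one_add_one_ne_zero m (add_eq_left.1 h)
  rcases hstep 0 with h0 | h0
  · refine ⟨(true, φ 0), ?_⟩
    have hind : ∀ i, φ i = φ 0 + i ∧ φ (i + 1) = φ i + 1 := by
      intro i
      induction i using Fin.induction with
      | zero => exact ⟨(add_zero _).symm, h0⟩
      | succ i ih =>
        rw [← Fin.coeSucc_eq_succ]
        refine ⟨by rw [ih.2, ih.1, add_assoc], ?_⟩
        rcases hstep (i.castSucc + 1) with h | h
        · exact h
        · rw [ih.2] at h
          exact absurd (add_right_cancel h).symm (hback _)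
    funext i
    simp only [cycleRelabel, if_true]
    rw [← (hind i).1, hφ]
  · refine ⟨(false, φ 0), ?_⟩
    have hind : ∀ i, φ i = φ 0 - i ∧ φ i = φ (i + 1) + 1 := by
      intro i
      induction i using Fin.induction with
      | zero => exact ⟨(sub_zero _).symm, h0⟩
      | succ i ih =>
        rw [← Fin.coeSucc_eq_succ]
        refine ⟨by rw [sub_add_eq_sub_sub, ← ih.1, eq_sub_iff_add_eq, ← ih.2], ?_⟩
        rcases hstep (i.castSucc + 1) with h | h
        · rw [← ih.2] at h
          exact absurd h (hback _)
        · exact h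
    funext i
    simp only [cycleRelabel, Bool.false_eq_true, if_false]
    rw [← (hind i).1, hφ]

theorem card_filter_cycleEdges_eq {V : Type*} [DecidableEq V] [Fintype V] {m : ℕ} {f : Fin (m + 3) → V}
    (hf : Function.Injective f) [DecidablePred fun g : Fin (m + 3) → V =>
      Function.Injective g ∧ cycleEdges g = cycleEdges f] :
    (Finset.univ.filter fun g : Fin (m + 3) → V =>
      Function.Injective g ∧ cycleEdges g = cycleEdges f).card = 2 * (m + 3) := by
  have : (Finset.univ.filter fun g : Fin (m + 3) → V =>
      Function.Injective g ∧ cycleEdges g = cycleEdges f) =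
      Finset.univ.image (cycleRelabel f) := by
    ext g
    simp only [Finset.mem_filter, Finset.mem_univ, true_and, Finset.mem_image]
    constructor
    · rintro ⟨hg, h⟩
      exact exists_cycleRelabel_eq hf hg h.le
    · rintro ⟨x, rfl⟩
      exact ⟨injective_cycleRelabel hf x, cycleEdges_cycleRelabel f x⟩
  rw [this, Finset.card_image_of_injective _ (cycleRelabel_injective hf)]
  simp

theorem cycleGraph_adj_iff {m : ℕ} {i j : Fin (m + 3)} :
    (SimpleGraph.cycleGraph (m + 3)).Adj i j ↔ j = i + 1 ∨ i = j + 1 := by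
  rw [SimpleGraph.cycleGraph_adj, sub_eq_iff_eq_add, sub_eq_iff_eq_add, add_comm 1 j,
    add_comm 1 i, or_comm]

theorem toSubgraph_adj_iff {V : Type*} [DecidableEq V] {m : ℕ} {G : SimpleGraph V}
    (f : (SimpleGraph.cycleGraph (m + 3)).Copy G) (a b : V) :
    f.toSubgraph.Adj a b ↔ s(a, b) ∈ cycleEdges f := by
  simp only [SimpleGraph.Copy.toSubgraph, SimpleGraph.Subgraph.map_adj, Relation.Map,
    SimpleGraph.Subgraph.top_adj, cycleGraph_adj_iff, cycleEdges, Finset.mem_image,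
    Finset.mem_univ, true_and]
  constructor
  · rintro ⟨i, j, rfl | rfl, rfl, rfl⟩
    · exact ⟨i, rfl⟩
    · exact ⟨j, Sym2.eq_swap⟩
  · rintro ⟨i, h⟩
    rcases Sym2.eq_iff.1 h with ⟨rfl, rfl⟩ | ⟨rfl, rfl⟩
    · exact ⟨i, i + 1, Or.inl rfl, rfl, rfl⟩
    · exact ⟨i + 1, i, Or.inr rfl, rfl, rfl⟩

-- A cycle subgraph is determined by its edge set, and each edge set arises from exactly $2k$
-- labellings, the rotations and reflections of one of them.
open Classical in
theorem two_mul_mul_cycleCount {n : ℕ} (m : ℕ) (G : SimpleGraph (Fin n)) :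
    2 * (m + 3) * cycleCount (m + 3) G =
      (Finset.univ.filter fun f : Fin (m + 3) → Fin n =>
        Function.Injective f ∧ (cycleEdges f : Set (Sym2 (Fin n))) ⊆ G.edgeSet).card := by
  set S := Finset.univ.filter fun f : Fin (m + 3) → Fin n =>
        Function.Injective f ∧ (cycleEdges f : Set (Sym2 (Fin n))) ⊆ G.edgeSet with hS
  have hedge : ∀ f : (SimpleGraph.cycleGraph (m + 3)).Copy G,
      f.toSubgraph.edgeSet.toFinset = cycleEdges f := by
    intro f
    ext e
    induction e with | h a b =>
      rw [Set.mem_toFinset, SimpleGraph.Subgraph.mem_edgeSet, toSubgraph_adj_iff]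
  have hinj : ∀ f : (SimpleGraph.cycleGraph (m + 3)).Copy G, Function.Injective f :=
    fun f => f.injective
  have h1 : cycleCount (m + 3) G = (S.image cycleEdges).card := by
    rw [cycleCount, SimpleGraph.copyCount_eq_card_image_copyToSubgraph,
      ← Finset.card_image_of_injOn (f := fun B : G.Subgraph => B.edgeSet.toFinset),
      Finset.image_image]
    · congr 1
      ext E
      simp only [Finset.mem_image, Finset.mem_univ, true_and, Function.comp, hedge, hS,
        Finset.mem_filter]
      constructor
      · rintro ⟨f, rfl⟩
        refine ⟨f, ⟨hinj f, ?_⟩, rfl⟩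
        rw [← hedge, Set.coe_toFinset]
        exact f.toSubgraph.edgeSet_subset
      · rintro ⟨f, ⟨hf, hfG⟩, rfl⟩
        have hadj : ∀ i, G.Adj (f i) (f (i + 1)) := fun i =>
          hfG (Finset.mem_coe.2 (Finset.mem_image_of_mem _ (Finset.mem_univ i)))
        refine ⟨⟨⟨f, ?_⟩, hf⟩, rfl⟩
        intro i j hij
        rcases cycleGraph_adj_iff.1 hij with rfl | rfl
        · exact hadj i
        · exact (hadj j).symm
    · intro B hB B' hB' h
      simp only [Finset.coe_image, Finset.coe_univ, Set.image_univ, Set.mem_range] at hB hB'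
      obtain ⟨f, rfl⟩ := hB
      obtain ⟨g, rfl⟩ := hB'
      simp only [hedge] at h
      ext a b
      · obtain ⟨x, hx⟩ := exists_cycleRelabel_eq (hinj f) (hinj g) h.ge
        obtain ⟨y, hy⟩ := exists_cycleRelabel_eq (hinj g) (hinj f) h.le
        simp only [SimpleGraph.Copy.toSubgraph, SimpleGraph.Subgraph.map_verts,
          SimpleGraph.Subgraph.verts_top, Set.image_univ, Set.mem_range]
        constructor
        · rintro ⟨i, rfl⟩
          exact ⟨_, congrFun hy i⟩
        · rintro ⟨i, rfl⟩
          exact ⟨_, congrFun hx i⟩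
      · rw [toSubgraph_adj_iff, toSubgraph_adj_iff, h]
  rw [h1, Finset.card_eq_sum_card_image cycleEdges S, mul_comm, ← smul_eq_mul,
    ← Finset.sum_const]
  refine (Finset.sum_congr rfl fun E hE => ?_).symm
  obtain ⟨f, hf, rfl⟩ := Finset.mem_image.1 hE
  obtain ⟨hf, hfG⟩ := (Finset.mem_filter.1 hf).2
  rw [← card_filter_cycleEdges_eq hf]
  congr 1
  ext g
  simp only [hS, Finset.mem_filter, Finset.mem_univ, true_and]
  constructor
  · rintro ⟨⟨h1, -⟩, h2⟩
    exact ⟨h1, h2⟩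
  · rintro ⟨h1, h2⟩
    exact ⟨⟨h1, h2 ▸ hfG⟩, h2⟩

/-- Two distinct intersecting cycles have fewer vertices than edges. -/
theorem card_range_lt_card_cycleEdges_union {V : Type*} [DecidableEq V] {m : ℕ}
    {f g : Fin (m + 3) → V} (hf : Function.Injective f) (hg : Function.Injective g)
    (hfg : ¬ Disjoint (Set.range f) (Set.range g)) (hne : cycleEdges g ≠ cycleEdges f) :
    (Finset.univ.image (Sum.elim f g)).card < (cycleEdges f ∪ cycleEdges g).card := by
  have himage : Finset.univ.image (Sum.elim f g) =
      Finset.univ.image f ∪ Finset.univ.image g := by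
    ext v
    simp
  set A := Finset.univ.image f
  have hA : A.card = m + 3 := by
    rw [Finset.card_image_of_injective _ hf]; simp
  -- `W` indexes the vertices that `g` adds to those of `f`. It must be shown to be smaller than the
  -- set of edges that `g` adds.
  set W : Finset (Fin (m + 3)) := Finset.univ.filter fun i => g i ∉ A with hW
  have hv : (A ∪ Finset.univ.image g).card = m + 3 + W.card := by
    have : A ∪ Finset.univ.image g = A ∪ W.image g := by
      ext v
      simp only [Finset.mem_union, Finset.mem_image, Finset.mem_univ, true_and, hW,
        Finset.mem_filter]
      constructor
      · rintro (h | ⟨i, rfl⟩)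
        · exact Or.inl h
        · by_cases h : g i ∈ A
          · exact Or.inl h
          · exact Or.inr ⟨i, h, rfl⟩
      · rintro (h | ⟨i, -, rfl⟩)
        · exact Or.inl h
        · exact Or.inr ⟨i, rfl⟩
    rw [this, Finset.card_union_of_disjoint, hA, Finset.card_image_of_injective _ hg]
    rw [Finset.disjoint_right]
    intro v hv
    obtain ⟨i, hi, rfl⟩ := Finset.mem_image.1 hv
    exact (Finset.mem_filter.1 hi).2
  rw [himage, hv, ← Finset.union_sdiff_self_eq_union,
    Finset.card_union_of_disjoint Finset.disjoint_sdiff, card_cycleEdges hf]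
  refine Nat.add_lt_add_left ?_ _
  -- With no new vertex, one new edge suffices, and distinctness of the edge sets provides it.
  by_cases hW0 : W = ∅
  · rw [hW0, Finset.card_empty, Finset.card_pos, Finset.sdiff_nonempty]
    intro hsub
    exact hne (Finset.eq_of_subset_of_card_le hsub (by rw [card_cycleEdges hf, card_cycleEdges hg]))
  -- `W'` indexes the edges of `g` with a new endpoint, which cannot be edges of `f`. If it were no
  -- larger than `W`, the successor of an old vertex would always be old; starting from a common
  -- vertex, all of `g` would be old.
  set W' : Finset (Fin (m + 3)) := Finset.univ.filter fun i => g i ∉ A ∨ g (i + 1) ∉ A with hW'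
  have hW'card : W'.card ≤ (cycleEdges g \ cycleEdges f).card := by
    refine Finset.card_le_card_of_injOn (fun i => s(g i, g (i + 1))) ?_
      (cycleEdges_mk_injective hg).injOn
    intro i hi
    simp only [Finset.coe_sdiff, Set.mem_sdiff, Finset.mem_coe]
    refine ⟨Finset.mem_image_of_mem _ (Finset.mem_univ i), fun he => ?_⟩
    have hmem : ∀ v ∈ s(g i, g (i + 1)), v ∈ A := fun v hv => by
      simpa [A] using mem_range_of_mem_cycleEdges he hv
    rcases (Finset.mem_filter.1 hi).2 with h | h
    · exact h (hmem _ (Sym2.mem_mk_left _ _))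
    · exact h (hmem _ (Sym2.mem_mk_right _ _))
  refine lt_of_lt_of_le (Finset.card_lt_card ?_) hW'card
  have hWW' : W ⊆ W' := fun i hi => by
    simp only [hW, hW', Finset.mem_filter, Finset.mem_univ, true_and] at hi ⊢
    exact Or.inl hi
  refine (Finset.ssubset_iff_subset_ne).2 ⟨hWW', fun heq => ?_⟩
  have hclosed : ∀ i, g (i + 1) ∉ A → g i ∉ A := by
    intro i hi
    have : i ∈ W' := by simp [hW', hi]
    rw [← heq] at this
    exact (Finset.mem_filter.1 this).2
  obtain ⟨v, ⟨j, rfl⟩, ⟨i, hi⟩⟩ := Set.not_disjoint_iff.1 hfg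
  have hiA : g i ∈ A := by rw [hi]; simp [A]
  have hall : ∀ l : Fin (m + 3), g (i + l) ∈ A := by
    intro l
    induction l using Fin.induction with
    | zero => simpa using hiA
    | succ l ih =>
      rw [← Fin.coeSucc_eq_succ, ← add_assoc]
      by_contra h
      exact hclosed _ h ih
  apply hW0
  rw [Finset.eq_empty_iff_forall_notMem]
  intro l hl
  apply (Finset.mem_filter.1 hl).2
  simpa using hall (l - i)

/-! ### Joint probabilities of labelled cycles, as traces. -/

/-- Labels of vertices outside the range of `h` are independent of the rest, and their weights sum
to 1. -/
theorem sum_prod_mul_comp {s : ℕ} {V ι : Type*} [Fintype V] [DecidableEq V] [Fintype ι]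
    [DecidableEq ι] {π : Fin s → ℝ} (hπ : π ∈ stdSimplex ℝ (Fin s)) {h : ι → V}
    (hh : Function.Injective h) (F : (ι → Fin s) → ℝ) :
    ∑ σ : V → Fin s, (∏ v, π (σ v)) * F (σ ∘ h) = ∑ τ : ι → Fin s, (∏ i, π (τ i)) * F τ := by
  classical
  let e : ι ⊕ ↥(Set.range h)ᶜ ≃ V :=
    (Equiv.sumCongr (Equiv.ofInjective h hh) (Equiv.refl _)).trans (Equiv.Set.sumCompl _)
  have he : ∀ i, e (Sum.inl i) = h i := fun i => by simp [e]
  let E : (V → Fin s) ≃ (ι → Fin s) × (↥(Set.range h)ᶜ → Fin s) :=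
    (Equiv.arrowCongr e.symm (Equiv.refl _)).trans (Equiv.sumArrowEquivProdArrow _ _ _)
  have hE1 : ∀ σ, (E σ).1 = σ ∘ h := fun σ => funext fun i => by simp [E, ← he]
  have hE2 : ∀ σ, ∏ v, π (σ v) = (∏ i, π ((E σ).1 i)) * ∏ i, π ((E σ).2 i) := by
    intro σ
    rw [← Equiv.prod_comp e, Fintype.prod_sum_type]
    rfl
  calc ∑ σ : V → Fin s, (∏ v, π (σ v)) * F (σ ∘ h)
      = ∑ σ, (fun x : (ι → Fin s) × (↥(Set.range h)ᶜ → Fin s) =>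
          (∏ i, π (x.1 i)) * (∏ i, π (x.2 i)) * F x.1) (E σ) :=
        Finset.sum_congr rfl fun σ _ => by simp only [hE2 σ, hE1 σ]
    _ = ∑ τ : ι → Fin s, (∏ i, π (τ i)) * F τ := by
        refine (Equiv.sum_comp E fun x : (ι → Fin s) × (↥(Set.range h)ᶜ → Fin s) =>
          (∏ i, π (x.1 i)) * (∏ i, π (x.2 i)) * F x.1).trans ?_
        rw [Fintype.sum_prod_type]
        refine Finset.sum_congr rfl fun τ _ => ?_
        dsimp only
        rw [← Finset.sum_mul, ← Finset.mul_sum, sum_prod_eq_one hπ, mul_one]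

/-- `τ` lists the interior points of a walk from `a` to `b`: `Fin.cons a τ` gives the sources of its
steps and `Fin.snoc τ b` the targets. -/
theorem pow_apply_eq_sum {s : ℕ} (A : Matrix (Fin s) (Fin s) ℝ) (m : ℕ) (a b : Fin s) :
    (A ^ (m + 1)) a b = ∑ τ : Fin m → Fin s, ∏ i : Fin (m + 1),
      A (Fin.cons (α := fun _ => Fin s) a τ i) (Fin.snoc (α := fun _ => Fin s) τ b i) := by
  induction m generalizing a with
  | zero => simp [Fin.snoc]
  | succ m ih =>
    rw [pow_succ', Matrix.mul_apply, ← (Fin.consEquiv fun _ => Fin s).sum_comp,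
      Fintype.sum_prod_type]
    refine Finset.sum_congr rfl fun c _ => ?_
    rw [ih, Finset.mul_sum]
    refine Finset.sum_congr rfl fun τ _ => ?_
    rw [Fin.prod_univ_succ (n := m + 1)]
    simp only [Fin.consEquiv, Equiv.coe_fn_mk, ← Fin.cons_snoc_eq_snoc_cons, Fin.cons_zero,
      Fin.cons_succ]

theorem trace_pow_eq_sum {s : ℕ} (A : Matrix (Fin s) (Fin s) ℝ) (m : ℕ) :
    (A ^ (m + 1)).trace = ∑ τ : Fin (m + 1) → Fin s, ∏ i, A (τ i) (τ (i + 1)) := by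
  rw [← (Fin.consEquiv fun _ => Fin s).sum_comp, Fintype.sum_prod_type, Matrix.trace]
  refine Finset.sum_congr rfl fun a _ => ?_
  rw [Matrix.diag_apply, pow_apply_eq_sum]
  refine Finset.sum_congr rfl fun τ _ => Finset.prod_congr rfl fun i _ => ?_
  simp only [Fin.consEquiv, Equiv.coe_fn_mk]
  congr 1
  induction i using Fin.lastCases with
  | last => simp
  | cast i => rw [Fin.snoc_castSucc, Fin.coeSucc_eq_succ, Fin.cons_succ]

/-- The matrix of edge probabilities. -/
noncomputable def edgeMatrix {s : ℕ} (n : ℕ) (M : Matrix (Fin s) (Fin s) ℝ) :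
    Matrix (Fin s) (Fin s) ℝ :=
  Matrix.of fun i j => (edgeProb n (M i j) : ℝ)

/-- The probability that a given labelled `k`-cycle lies in the graph. -/
noncomputable def cycleProb {s : ℕ} (n : ℕ) (M : Matrix (Fin s) (Fin s) ℝ) (π : Fin s → ℝ)
    (k : ℕ) : ℝ :=
  ((Matrix.diagonal π * edgeMatrix n M) ^ k).trace

theorem cycleProb_eq_sum {s : ℕ} (n : ℕ) (M : Matrix (Fin s) (Fin s) ℝ) (π : Fin s → ℝ) (m : ℕ) :
    cycleProb n M π (m + 1) = ∑ τ : Fin (m + 1) → Fin s, (∏ i, π (τ i)) *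
      ∏ i, (edgeProb n (M (τ i) (τ (i + 1))) : ℝ) := by
  rw [cycleProb, trace_pow_eq_sum]
  refine Finset.sum_congr rfl fun τ _ => ?_
  rw [← Finset.prod_mul_distrib]
  refine Finset.prod_congr rfl fun i _ => ?_
  rw [Matrix.diagonal_mul, edgeMatrix, Matrix.of_apply]

theorem cycleProb_nonneg {s : ℕ} (n : ℕ) (M : Matrix (Fin s) (Fin s) ℝ) {π : Fin s → ℝ}
    (hπ : ∀ i, 0 ≤ π i) (m : ℕ) : 0 ≤ cycleProb n M π (m + 1) := by
  rw [cycleProb_eq_sum]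
  exact Finset.sum_nonneg fun τ _ => mul_nonneg (Finset.prod_nonneg fun _ _ => hπ _)
    (Finset.prod_nonneg fun _ _ => edgeProb_nonneg _ _)

open Classical in
/-- The indicator that the labelled cycle `f` lies in `G`. -/
noncomputable def cycleIndicator {n m : ℕ} (f : Fin (m + 3) → Fin n) (G : SimpleGraph (Fin n)) :
    ℝ :=
  if (cycleEdges f : Set (Sym2 (Fin n))) ⊆ G.edgeSet then 1 else 0

section

variable {s n m : ℕ} {M : Matrix (Fin s) (Fin s) ℝ} {π : Fin s → ℝ}

theorem expect_cycleIndicator (hM : M.IsSymm) (hπ : π ∈ stdSimplex ℝ (Fin s))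
    {f : Fin (m + 3) → Fin n} (hf : Function.Injective f) :
    expect n M π (cycleIndicator f) = cycleProb n M π (m + 3) := by
  unfold cycleIndicator
  rw [expect_indicator_subset _ _ _ _ fun e => not_isDiag_of_mem_cycleEdges hf,
    cycleProb_eq_sum, ← sum_prod_mul_comp hπ hf]
  refine Finset.sum_congr rfl fun σ _ => ?_
  rw [prod_cycleEdges hf]
  simp only [pairProb_mk hM, Function.comp]

theorem expect_cycleIndicator_mul_eq (f g : Fin (m + 3) → Fin n)
    (hf : Function.Injective f) (hg : Function.Injective g) :
    expect n M π (fun G => cycleIndicator f G * cycleIndicator g G) =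
      ∑ σ : Fin n → Fin s, (∏ v, π (σ v)) * ∏ e ∈ cycleEdges f ∪ cycleEdges g, pairProb n M σ e := by
  classical
  rw [← expect_indicator_subset]
  · congr 1
    funext G
    simp only [cycleIndicator, Finset.coe_union, Set.union_subset_iff, ite_and, ite_mul, one_mul,
      zero_mul]
  · intro e he
    rcases Finset.mem_union.1 he with h | h
    · exact not_isDiag_of_mem_cycleEdges hf h
    · exact not_isDiag_of_mem_cycleEdges hg h

/-- Disjoint cycles share neither edges nor labels, so their indicators are independent even after
averaging over the labels. -/
theorem expect_cycleIndicator_mul_of_disjoint (hM : M.IsSymm) (hπ : π ∈ stdSimplex ℝ (Fin s))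
    {f g : Fin (m + 3) → Fin n} (hf : Function.Injective f) (hg : Function.Injective g)
    (hfg : Disjoint (Set.range f) (Set.range g)) :
    expect n M π (fun G => cycleIndicator f G * cycleIndicator g G) =
      cycleProb n M π (m + 3) ^ 2 := by
  have hh : Function.Injective (Sum.elim f g) :=
    hf.sumElim hg fun a b h => Set.disjoint_left.1 hfg ⟨a, rfl⟩ ⟨b, h.symm⟩
  rw [expect_cycleIndicator_mul_eq f g hf hg]
  let Φ : (Fin (m + 3) → Fin s) → ℝ := fun τ => ∏ i, (edgeProb n (M (τ i) (τ (i + 1))) : ℝ)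
  have h1 : ∀ σ : Fin n → Fin s, ∏ e ∈ cycleEdges f ∪ cycleEdges g, pairProb n M σ e =
      (fun τ : Fin (m + 3) ⊕ Fin (m + 3) → Fin s => Φ (τ ∘ Sum.inl) * Φ (τ ∘ Sum.inr))
        (σ ∘ Sum.elim f g) := by
    intro σ
    rw [Finset.prod_union (disjoint_cycleEdges hfg), prod_cycleEdges hf, prod_cycleEdges hg]
    simp only [pairProb_mk hM, Φ, Function.comp, Sum.elim_inl, Sum.elim_inr]
  have h2 := sum_prod_mul_comp hπ hh
    (fun τ : Fin (m + 3) ⊕ Fin (m + 3) → Fin s => Φ (τ ∘ Sum.inl) * Φ (τ ∘ Sum.inr))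
  refine (Finset.sum_congr rfl fun σ _ => by rw [h1 σ]).trans (h2.trans ?_)
  rw [← (Equiv.sumArrowEquivProdArrow _ _ _).symm.sum_comp,
    Fintype.sum_prod_type, sq, cycleProb_eq_sum, Finset.sum_mul_sum]
  refine Finset.sum_congr rfl fun τ _ => Finset.sum_congr rfl fun τ' _ => ?_
  rw [Fintype.prod_sum_type]
  simp only [Equiv.sumArrowEquivProdArrow, Equiv.coe_fn_symm_mk, Sum.elim_inl, Sum.elim_inr, Φ,
    Function.comp]
  ring

/-- Each edge costs at most $B/n$, and there is at least one more edge than there are vertices. The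
extra $1/n$ is split off so that the other factor, $n^{-v}$ for $v$ vertices, has a bounded sum over
all pairs. -/
theorem expect_cycleIndicator_mul_le (hM0 : ∀ i j, 0 ≤ M i j) (hπ : π ∈ stdSimplex ℝ (Fin s))
    {B : ℝ} (hB1 : 1 ≤ B) (hB : ∀ i j, M i j ≤ B) (hn : 1 ≤ n)
    {f g : Fin (m + 3) → Fin n} (hf : Function.Injective f) (hg : Function.Injective g)
    (hfg : ¬ Disjoint (Set.range f) (Set.range g)) (hne : cycleEdges g ≠ cycleEdges f) :
    expect n M π (fun G => cycleIndicator f G * cycleIndicator g G) ≤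
      B ^ (2 * (m + 3)) / n * (1 / n : ℝ) ^ (Finset.univ.image (Sum.elim f g)).card := by
  have hn' : (1 : ℝ) ≤ n := by exact_mod_cast hn
  have hn0 : (0 : ℝ) < n := by linarith
  rw [expect_cycleIndicator_mul_eq f g hf hg]
  set E := cycleEdges f ∪ cycleEdges g with hE
  have hEcard : E.card ≤ 2 * (m + 3) := by
    refine (Finset.card_union_le _ _).trans ?_
    rw [card_cycleEdges hf, card_cycleEdges hg]
    omega
  have hlt := card_range_lt_card_cycleEdges_union hf hg hfg hne
  have hp : ∀ (σ : Fin n → Fin s) e, pairProb n M σ e ≤ B * (1 / n) := by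
    intro σ e
    rw [pairProb, coe_edgeProb (hM0 _ _), mul_one_div]
    exact (min_le_right _ _).trans (by gcongr; exact hB _ _)
  have hprod : ∀ σ : Fin n → Fin s, ∏ e ∈ E, pairProb n M σ e ≤
      B ^ (2 * (m + 3)) / n * (1 / n : ℝ) ^ (Finset.univ.image (Sum.elim f g)).card := by
    intro σ
    calc ∏ e ∈ E, pairProb n M σ e ≤ ∏ _e ∈ E, B * (1 / n : ℝ) :=
          Finset.prod_le_prod (fun e _ => edgeProb_nonneg _ _) fun e _ => hp σ e
      _ = B ^ E.card * (1 / n : ℝ) ^ E.card := by rw [Finset.prod_const, mul_pow]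
      _ ≤ B ^ (2 * (m + 3)) *
          (1 / n : ℝ) ^ ((Finset.univ.image (Sum.elim f g)).card + 1) := by
          refine mul_le_mul (pow_le_pow_right₀ hB1 hEcard) ?_ (by positivity) (by positivity)
          exact pow_le_pow_of_le_one (by positivity) ((div_le_one hn0).2 hn') hlt
      _ = _ := by rw [pow_succ]; ring
  refine (Finset.sum_le_sum fun σ _ => mul_le_mul_of_nonneg_left (hprod σ)
    (Finset.prod_nonneg fun v _ => hπ.1 _)).trans ?_
  rw [← Finset.sum_mul, sum_prod_eq_one hπ, one_mul]

end

/-! ### First and second moments of the cycle count. -/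

/-- At most $n^v v^{|\iota|}$ maps have an image of size $v$, so the bound does not depend on $n$.
-/
theorem sum_inv_pow_card_image_le {ι : Type*} [Fintype ι] [DecidableEq ι] {n : ℕ} (hn : 1 ≤ n) :
    ∑ h : ι → Fin n, (1 / n : ℝ) ^ (Finset.univ.image h).card ≤
      ∑ v ∈ Finset.range (Fintype.card ι + 1), (v : ℝ) ^ Fintype.card ι := by
  have hn0 : (0 : ℝ) < n := by exact_mod_cast hn
  rw [← Finset.sum_fiberwise_of_maps_to (s := Finset.univ)
    (t := Finset.range (Fintype.card ι + 1)) (g := fun h : ι → Fin n => (Finset.univ.image h).card)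
    fun h _ => Finset.mem_range.2 (Nat.lt_succ_of_le Finset.card_image_le)]
  refine Finset.sum_le_sum fun v _ => ?_
  rw [Finset.sum_congr rfl fun h hh => by rw [(Finset.mem_filter.1 hh).2], Finset.sum_const,
    nsmul_eq_mul]
  have hcard : (Finset.univ.filter fun h : ι → Fin n => (Finset.univ.image h).card = v).card ≤
      n ^ v * v ^ Fintype.card ι := by
    have hsub : (Finset.univ.filter fun h : ι → Fin n => (Finset.univ.image h).card = v) ⊆
        (Finset.powersetCard v (Finset.univ : Finset (Fin n))).biUnion
          fun U => Fintype.piFinset fun _ : ι => U := by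
      intro h hh
      refine Finset.mem_biUnion.2 ⟨Finset.univ.image h, ?_, ?_⟩
      · simpa [Finset.mem_powersetCard] using hh
      · simp [Fintype.mem_piFinset]
    refine (Finset.card_le_card hsub).trans ((Finset.card_biUnion_le_card_mul _ _
      (v ^ Fintype.card ι) ?_).trans ?_)
    · intro U hU
      rw [Fintype.card_piFinset, Finset.prod_const, (Finset.mem_powersetCard.1 hU).2,
        Finset.card_univ]
    · rw [Finset.card_powersetCard, Finset.card_univ, Fintype.card_fin]
      exact Nat.mul_le_mul_right _ (Nat.choose_le_pow n v)
  calc _ ≤ ((n ^ v * v ^ Fintype.card ι : ℕ) : ℝ) * (1 / n : ℝ) ^ v := by gcongr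
    _ = (v : ℝ) ^ Fintype.card ι := by
      push_cast
      rw [one_div, inv_pow]
      field_simp

section

variable {s n m : ℕ} {M : Matrix (Fin s) (Fin s) ℝ} {π : Fin s → ℝ}

open Classical in
theorem two_mul_mul_cycleCount_eq_sum (G : SimpleGraph (Fin n)) :
    2 * (m + 3) * (cycleCount (m + 3) G : ℝ) =
      ∑ f : Fin (m + 3) → Fin n with Function.Injective f, cycleIndicator f G := by
  have h := two_mul_mul_cycleCount m G
  rw [← Finset.filter_filter, Finset.card_filter] at h
  simp only [cycleIndicator]
  exact_mod_cast h

open Classical in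
theorem card_filter_injective (k n : ℕ) :
    (Finset.univ.filter fun f : Fin k → Fin n => Function.Injective f).card =
      n.descFactorial k := by
  rw [← Fintype.card_subtype, Fintype.card_congr (Equiv.subtypeInjectiveEquivEmbedding _ _),
    Fintype.card_embedding_eq]
  simp

theorem expect_cycleCount (hM : M.IsSymm) (hπ : π ∈ stdSimplex ℝ (Fin s)) :
    expect n M π (fun G => 2 * (m + 3) * (cycleCount (m + 3) G : ℝ)) =
      n.descFactorial (m + 3) * cycleProb n M π (m + 3) := by
  classical
  simp only [two_mul_mul_cycleCount_eq_sum]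
  rw [expect_sum, Finset.sum_congr rfl fun f hf =>
    expect_cycleIndicator hM hπ (Finset.mem_filter.1 hf).2, Finset.sum_const,
    card_filter_injective, nsmul_eq_mul]

/-- The three terms bound the contributions of disjoint pairs, pairs with the same edge set ($2k$
choices of `g` for each `f`), and the remaining intersecting pairs. -/
theorem expect_cycleCount_sq_le (hM : M.IsSymm) (hM0 : ∀ i j, 0 ≤ M i j)
    (hπ : π ∈ stdSimplex ℝ (Fin s)) {B : ℝ} (hB1 : 1 ≤ B) (hB : ∀ i j, M i j ≤ B) (hn : 1 ≤ n) :
    expect n M π (fun G => (2 * (m + 3) * (cycleCount (m + 3) G : ℝ)) ^ 2) ≤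
      (n.descFactorial (m + 3) * cycleProb n M π (m + 3)) ^ 2 +
      2 * (m + 3) * (n.descFactorial (m + 3) * cycleProb n M π (m + 3)) +
      B ^ (2 * (m + 3)) / n * ∑ v ∈ Finset.range (Fintype.card (Fin (m + 3) ⊕ Fin (m + 3)) + 1),
        (v : ℝ) ^ Fintype.card (Fin (m + 3) ⊕ Fin (m + 3)) := by
  classical
  set a := cycleProb n M π (m + 3) with ha
  have ha0 : 0 ≤ a := cycleProb_nonneg n M hπ.1 (m + 2)
  set I := Finset.univ.filter fun f : Fin (m + 3) → Fin n => Function.Injective f with hI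
  have hIcard : I.card = n.descFactorial (m + 3) := card_filter_injective _ _
  set R : ℝ := B ^ (2 * (m + 3)) / n with hR
  have hR0 : 0 ≤ R := by positivity
  set c : (Fin (m + 3) ⊕ Fin (m + 3) → Fin n) → ℝ :=
    fun h => (1 / n : ℝ) ^ (Finset.univ.image h).card with hc
  have hc0 : ∀ h, 0 ≤ c h := fun h => by positivity
  have hpair : ∀ f ∈ I, ∀ g ∈ I,
      expect n M π (fun G => cycleIndicator f G * cycleIndicator g G) ≤
        a ^ 2 + (if cycleEdges g = cycleEdges f then a else 0) + R * c (Sum.elim f g) := by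
    intro f hf g hg
    have hf := (Finset.mem_filter.1 hf).2
    have hg := (Finset.mem_filter.1 hg).2
    have hRc : 0 ≤ R * c (Sum.elim f g) := mul_nonneg hR0 (hc0 _)
    have ha2 : 0 ≤ a ^ 2 := sq_nonneg a
    by_cases hd : Disjoint (Set.range f) (Set.range g)
    · rw [expect_cycleIndicator_mul_of_disjoint hM hπ hf hg hd]
      split_ifs <;> linarith
    · by_cases he : cycleEdges g = cycleEdges f
      · have : expect n M π (fun G => cycleIndicator f G * cycleIndicator g G) = a := by
          rw [ha, ← expect_cycleIndicator hM hπ hf]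
          congr 1
          funext G
          simp [cycleIndicator, he]
        rw [this, if_pos he]
        linarith
      · rw [if_neg he]
        have := expect_cycleIndicator_mul_le hM0 hπ hB1 hB hn hf hg hd he
        linarith
  have hexp : expect n M π (fun G => (2 * (m + 3) * (cycleCount (m + 3) G : ℝ)) ^ 2) =
      ∑ f ∈ I, ∑ g ∈ I, expect n M π (fun G => cycleIndicator f G * cycleIndicator g G) := by
    simp only [two_mul_mul_cycleCount_eq_sum, sq, Finset.sum_mul_sum]
    rw [expect_sum]
    exact Finset.sum_congr rfl fun f _ => expect_sum _ _ _ _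
  rw [hexp]
  refine (Finset.sum_le_sum fun f hf => Finset.sum_le_sum fun g hg => hpair f hf g hg).trans ?_
  simp only [Finset.sum_add_distrib]
  refine add_le_add (add_le_add (le_of_eq ?_) (le_of_eq ?_)) ?_
  · simp only [Finset.sum_const, nsmul_eq_mul, hIcard]
    ring
  · rw [Finset.sum_congr rfl (g := fun _ => 2 * ((m : ℝ) + 3) * a)]
    · rw [Finset.sum_const, nsmul_eq_mul, hIcard]
      ring
    · intro f hf
      rw [← Finset.sum_filter, Finset.sum_const, nsmul_eq_mul, hI, Finset.filter_filter,
        card_filter_cycleEdges_eq (Finset.mem_filter.1 hf).2]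
      push_cast
      ring
  · simp only [← Finset.mul_sum]
    refine mul_le_mul_of_nonneg_left ?_ hR0
    refine le_trans ?_ (sum_inv_pow_card_image_le hn)
    rw [← (Equiv.sumArrowEquivProdArrow _ _ _).symm.sum_comp, Fintype.sum_prod_type]
    -- Injectivity is dropped: the sum is enlarged to all pairs of maps.
    refine (Finset.sum_le_univ_sum_of_nonneg fun f =>
      Finset.sum_nonneg fun g _ => hc0 _).trans ?_
    refine Finset.sum_le_sum fun f _ => ?_
    exact Finset.sum_le_univ_sum_of_nonneg fun g => hc0 _

/-! ### Limits of the moments as $n \to \infty$. -/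

theorem tendsto_descFactorial_div_pow (k : ℕ) :
    Tendsto (fun n : ℕ => (n.descFactorial k : ℝ) / (n : ℝ) ^ k) atTop (𝓝 1) := by
  induction k with
  | zero => simp
  | succ k ih =>
    have h1 : Tendsto (fun n : ℕ => 1 - (k : ℝ) / n) atTop (𝓝 (1 - 0)) :=
      tendsto_const_nhds.sub (tendsto_const_div_atTop_nhds_zero_nat _)
    have h := h1.mul ih
    rw [sub_zero, one_mul] at h
    refine h.congr' ?_
    filter_upwards [eventually_ge_atTop (k + 1)] with n hn
    have hn0 : (n : ℝ) ≠ 0 := Nat.cast_ne_zero.2 (by omega)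
    rw [Nat.descFactorial_succ, Nat.cast_mul, Nat.cast_sub (by omega), pow_succ]
    field_simp

theorem eventually_cycleProb_eq (hM0 : ∀ i j, 0 ≤ M i j) (k : ℕ) :
    ∀ᶠ n : ℕ in atTop,
      cycleProb n M π k = ((Matrix.diagonal π * M) ^ k).trace / (n : ℝ) ^ k := by
  have h : ∀ᶠ n : ℕ in atTop, ∀ i j, M i j ≤ n :=
    eventually_all.2 fun i => eventually_all.2 fun j =>
      tendsto_natCast_atTop_atTop.eventually_ge_atTop _
  filter_upwards [h, eventually_ge_atTop 1] with n hn hn1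
  have hn0 : (0 : ℝ) < n := by exact_mod_cast hn1
  have : edgeMatrix n M = (1 / n : ℝ) • M := by
    ext i j
    rw [edgeMatrix, Matrix.of_apply, coe_edgeProb (hM0 i j),
      min_eq_right ((div_le_one hn0).2 (hn i j)), Matrix.smul_apply, smul_eq_mul]
    ring
  rw [cycleProb, this, Matrix.mul_smul, smul_pow, Matrix.trace_smul, smul_eq_mul, one_div,
    inv_pow]
  ring

theorem tendsto_descFactorial_mul_cycleProb (hM0 : ∀ i j, 0 ≤ M i j) (k : ℕ) :
    Tendsto (fun n : ℕ => (n.descFactorial k : ℝ) * cycleProb n M π k) atTop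
      (𝓝 ((Matrix.diagonal π * M) ^ k).trace) := by
  have h := (tendsto_descFactorial_div_pow k).mul_const ((Matrix.diagonal π * M) ^ k).trace
  rw [one_mul] at h
  refine h.congr' ?_
  filter_upwards [eventually_cycleProb_eq (π := π) hM0 k] with n hn
  rw [hn]
  ring

/-- The mean square deviation of the number of `k`-cycles from `tr ((diag π M) ^ k) / (2 k)` is
asymptotically at most that value. -/
theorem eventually_expect_cycleCount_sub_sq_le (hM : M.IsSymm) (hM0 : ∀ i j, 0 ≤ M i j)
    (hπ : π ∈ stdSimplex ℝ (Fin s)) {k : ℕ} (hk : 3 ≤ k) {μ : ℝ}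
    (hμ : μ = ((Matrix.diagonal π * M) ^ k).trace / (2 * k)) {η : ℝ} (hη : 0 < η) :
    ∀ᶠ n : ℕ in atTop,
      expect n M π (fun G => ((cycleCount k G : ℝ) - μ) ^ 2) ≤ μ + η := by
  obtain ⟨m, rfl⟩ : ∃ m, k = m + 3 := ⟨k - 3, by omega⟩
  obtain ⟨B, hB1, hB⟩ : ∃ B : ℝ, 1 ≤ B ∧ ∀ i j, M i j ≤ B := by
    refine ⟨1 + ∑ i, ∑ j, M i j, ?_, fun i j => ?_⟩
    · linarith [Finset.sum_nonneg fun i (_ : i ∈ Finset.univ) =>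
        Finset.sum_nonneg fun j (_ : j ∈ Finset.univ) => hM0 i j]
    · have h1 := Finset.single_le_sum (f := fun j => M i j) (fun j _ => hM0 i j)
        (Finset.mem_univ j)
      have h2 := Finset.single_le_sum (f := fun i => ∑ j, M i j)
        (fun i _ => Finset.sum_nonneg fun j _ => hM0 i j) (Finset.mem_univ i)
      linarith
  set K : ℝ := ∑ v ∈ Finset.range (Fintype.card (Fin (m + 3) ⊕ Fin (m + 3)) + 1),
        (v : ℝ) ^ Fintype.card (Fin (m + 3) ⊕ Fin (m + 3)) with hK
  set κ : ℝ := 2 * ((m : ℝ) + 3) with hκ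
  have hκ0 : 0 < κ := by positivity
  have hb := tendsto_descFactorial_mul_cycleProb (π := π) hM0 (m + 3)
  have htr : ((Matrix.diagonal π * M) ^ (m + 3)).trace = κ * μ := by
    rw [hμ, hκ]
    push_cast
    field_simp
  rw [htr] at hb
  have hlim : Tendsto (fun n : ℕ => (((n.descFactorial (m + 3) : ℝ) * cycleProb n M π (m + 3)) ^ 2
      + κ * ((n.descFactorial (m + 3) : ℝ) * cycleProb n M π (m + 3))
      + B ^ (2 * (m + 3)) / n * K) / κ ^ 2
      - 2 * μ / κ * ((n.descFactorial (m + 3) : ℝ) * cycleProb n M π (m + 3)) + μ ^ 2) atTop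
      (𝓝 (((κ * μ) ^ 2 + κ * (κ * μ) + 0 * K) / κ ^ 2 - 2 * μ / κ * (κ * μ) + μ ^ 2)) :=
    (((((hb.pow 2).add (hb.const_mul κ)).add
      ((tendsto_const_div_atTop_nhds_zero_nat _).mul_const K)).div_const _).sub
      (hb.const_mul _)).add_const _
  -- The squares of the mean cancel; the `μ` that remains comes from the pairs with the same edge
  -- set.
  have hval : ((κ * μ) ^ 2 + κ * (κ * μ) + 0 * K) / κ ^ 2 - 2 * μ / κ * (κ * μ) + μ ^ 2 = μ := by
    field_simp
    ring
  rw [hval] at hlim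
  filter_upwards [hlim.eventually_lt_const (lt_add_of_pos_right μ hη), eventually_ge_atTop 1]
    with n hn hn1
  have heq : expect n M π (fun G => ((cycleCount (m + 3) G : ℝ) - μ) ^ 2) =
      expect n M π (fun G => (κ * (cycleCount (m + 3) G : ℝ)) ^ 2) / κ ^ 2 -
      2 * μ / κ * ((n.descFactorial (m + 3) : ℝ) * cycleProb n M π (m + 3)) + μ ^ 2 := by
    rw [← expect_cycleCount hM hπ, div_eq_inv_mul, ← expect_const_mul, sub_eq_add_neg, ← neg_mul,
      ← expect_const_mul, ← expect_add]
    have hc : μ ^ 2 = expect n M π (fun _ => μ ^ 2 * 1) := by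
      rw [expect_const_mul, expect_one n M hπ, mul_one]
    rw [hc, ← expect_add]
    congr 1
    funext G
    simp only [← hκ]
    field_simp
    ring
  rw [heq]
  refine le_trans ?_ hn.le
  gcongr
  exact expect_cycleCount_sq_le hM hM0 hπ hB1 hB hn1

end

/-! ### The spectrum and the traces of powers of $T$. -/

theorem trace_pow_eq_sum_eigenvalues {n : Type*} [Fintype n] [DecidableEq n] {A : Matrix n n ℝ}
    (hA : A.IsHermitian) (k : ℕ) : (A ^ k).trace = ∑ i, hA.eigenvalues i ^ k := by
  conv_lhs => rw [hA.spectral_theorem, ← map_pow, Unitary.conjStarAlgAut_apply,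
    Matrix.trace_mul_comm, ← mul_assoc]
  simp [Matrix.diagonal_pow, Matrix.trace]

section

variable {s : ℕ} {M : Matrix (Fin s) (Fin s) ℝ} {π : Fin s → ℝ} {d : ℝ} {lam : Fin s → ℝ}

/-- With $D = \operatorname{diag}(\sqrt{\pi})$, $T = D \cdot (DM/d)$, and the reversed product
$(DM/d) \cdot D$ is symmetric. Both products have the same characteristic polynomial and the same
traces of powers; $D$ need not be invertible, so zeros of `π` are harmless. -/
theorem trace_pow_transitionMatrix (hM : M.IsSymm) (hπ : ∀ i, 0 ≤ π i)
    (hlam : IsEigenvalueList (transitionMatrix M π d) lam) (k : ℕ) :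
    (transitionMatrix M π d ^ k).trace = ∑ i, lam i ^ k := by
  set D : Matrix (Fin s) (Fin s) ℝ := Matrix.diagonal fun i => √(π i) with hD
  have hDD : D * D = Matrix.diagonal π := by
    rw [hD, Matrix.diagonal_mul_diagonal]
    congr 1
    funext i
    exact Real.mul_self_sqrt (hπ i)
  have hH : ((1 / d) • (D * M) * D).IsHermitian := by
    unfold Matrix.IsHermitian
    rw [Matrix.conjTranspose_eq_transpose_of_trivial]
    simp only [Matrix.transpose_smul, Matrix.transpose_mul, hM.eq, hD,
      Matrix.diagonal_transpose, Matrix.mul_assoc, Matrix.smul_mul]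
  have hT : transitionMatrix M π d = D * ((1 / d) • (D * M)) := by
    rw [transitionMatrix, ← hDD, Matrix.mul_smul, Matrix.mul_assoc]
  have hroots : Finset.univ.val.map lam = Finset.univ.val.map hH.eigenvalues := by
    have h := hlam.1
    rw [hT, Matrix.charpoly_mul_comm, hH.charpoly_eq] at h
    have h := congrArg Polynomial.roots h
    rw [Polynomial.roots_prod _ _ (Finset.prod_ne_zero_iff.2 fun i _ =>
        Polynomial.X_sub_C_ne_zero _),
      Polynomial.roots_prod _ _ (Finset.prod_ne_zero_iff.2 fun i _ =>
        Polynomial.X_sub_C_ne_zero _)] at h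
    simpa [Multiset.bind_singleton] using h.symm
  have hsum : ∑ i, lam i ^ k = ∑ i, hH.eigenvalues i ^ k := by
    have h := congrArg (fun S => (S.map (· ^ k)).sum) hroots
    simp only [Multiset.map_map] at h
    exact h
  rw [hsum, ← trace_pow_eq_sum_eigenvalues hH, hT]
  rcases k with _ | k
  · simp
  · generalize (1 / d) • (D * M) = B
    have hcomm : ∀ k : ℕ, (D * B) ^ k * D = D * (B * D) ^ k := by
      intro k
      induction k with
      | zero => simp
      | succ k ih => rw [pow_succ', pow_succ', mul_assoc, ih]; simp only [mul_assoc]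
    rw [pow_succ, ← mul_assoc, hcomm, mul_assoc, Matrix.trace_mul_comm, mul_assoc,
      pow_succ]

theorem transitionMatrix_nonneg (hM0 : ∀ i j, 0 ≤ M i j) (hπ : ∀ i, 0 ≤ π i) (hd0 : 0 < d)
    (i j : Fin s) : 0 ≤ transitionMatrix M π d i j := by
  rw [transitionMatrix, Matrix.smul_apply, Matrix.diagonal_mul, smul_eq_mul]
  have := hM0 i j
  have := hπ i
  positivity

theorem one_vecMul_transitionMatrix (hM : M.IsSymm) (hd0 : 0 < d)
    (hd : ∀ i, ∑ j, M i j * π j = d) :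
    Matrix.vecMul (fun _ => (1 : ℝ)) (transitionMatrix M π d) = fun _ => 1 := by
  funext j
  simp only [Matrix.vecMul, dotProduct, one_mul, transitionMatrix, Matrix.smul_apply,
    Matrix.diagonal_mul, smul_eq_mul]
  rw [← Finset.mul_sum, one_div, inv_mul_eq_one₀ hd0.ne', ← hd j]
  exact Finset.sum_congr rfl fun i _ => by rw [hM.apply, mul_comm]

/-- $T^k$ is non-negative with column sums 1, so its diagonal entries are at most 1. This keeps the
variance under the block model at the scale $d^k/k$. -/
theorem trace_pow_transitionMatrix_le (hM : M.IsSymm) (hM0 : ∀ i j, 0 ≤ M i j)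
    (hπ : ∀ i, 0 ≤ π i) (hd0 : 0 < d) (hd : ∀ i, ∑ j, M i j * π j = d) (k : ℕ) :
    (transitionMatrix M π d ^ k).trace ≤ s := by
  set T := transitionMatrix M π d with hT
  have hnonneg : ∀ k : ℕ, ∀ i j, 0 ≤ (T ^ k) i j := by
    intro k
    induction k with
    | zero =>
      intro i j
      rw [pow_zero, Matrix.one_apply]
      split_ifs <;> norm_num
    | succ k ih =>
      intro i j
      rw [pow_succ, Matrix.mul_apply]
      exact Finset.sum_nonneg fun l _ => mul_nonneg (ih i l)
        (transitionMatrix_nonneg hM0 hπ hd0 l j)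
  have hcol : ∀ k : ℕ, Matrix.vecMul (fun _ => (1 : ℝ)) (T ^ k) = fun _ => 1 := by
    intro k
    induction k with
    | zero => simp
    | succ k ih =>
      rw [pow_succ, ← Matrix.vecMul_vecMul, ih, hT, one_vecMul_transitionMatrix hM hd0 hd]
  have hle : ∀ i, (T ^ k) i i ≤ 1 := by
    intro i
    have h := congrFun (hcol k) i
    simp only [Matrix.vecMul, dotProduct, one_mul] at h
    rw [← h]
    exact Finset.single_le_sum (f := fun j => (T ^ k) j i) (fun j _ => hnonneg k j i)
      (Finset.mem_univ i)
  calc (T ^ k).trace = ∑ i, (T ^ k) i i := rfl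
    _ ≤ ∑ _i : Fin s, 1 := Finset.sum_le_sum fun i _ => hle i
    _ = s := by simp

theorem exists_eigenvalue_eq_one (hs : 2 ≤ s) (hM : M.IsSymm) (hd0 : 0 < d)
    (hd : ∀ i, ∑ j, M i j * π j = d)
    (hlam : IsEigenvalueList (transitionMatrix M π d) lam) : ∃ i, lam i = 1 := by
  have hdet : (Matrix.scalar (Fin s) (1 : ℝ) - transitionMatrix M π d).det = 0 := by
    refine Matrix.exists_vecMul_eq_zero_iff.1 ⟨fun _ => 1, ?_, ?_⟩
    · intro h
      exact one_ne_zero (congrFun h ⟨0, by omega⟩)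
    · rw [Matrix.vecMul_sub, one_vecMul_transitionMatrix hM hd0 hd]
      simp
  rw [← Matrix.eval_charpoly, hlam.1, Polynomial.eval_prod, Finset.prod_eq_zero_iff] at hdet
  obtain ⟨i, -, hi⟩ := hdet
  have hi : 1 - lam i = 0 := by simpa using hi
  exact ⟨i, by linarith⟩

/-- For even $k$ all terms $\lambda_i^k$ are non-negative, so two of them can be kept. If the
eigenvalue found to be 1 sits at index 1, it is paired with the one at index 0, whose absolute value
is at least 1. -/
theorem one_add_pow_le_trace_pow (hs : 2 ≤ s) (hM : M.IsSymm) (hπ : ∀ i, 0 ≤ π i) (hd0 : 0 < d)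
    (hd : ∀ i, ∑ j, M i j * π j = d)
    (hlam : IsEigenvalueList (transitionMatrix M π d) lam) {k : ℕ} (hk : Even k) :
    1 + lam ⟨1, hs⟩ ^ k ≤ (transitionMatrix M π d ^ k).trace := by
  rw [trace_pow_transitionMatrix hM hπ hlam]
  obtain ⟨i, hi⟩ := exists_eigenvalue_eq_one hs hM hd0 hd hlam
  have hpair : ∀ a b : Fin s, a ≠ b → lam a ^ k + lam b ^ k ≤ ∑ i, lam i ^ k := by
    intro a b hab
    rw [← Finset.sum_pair (f := fun i => lam i ^ k) hab]
    exact Finset.sum_le_univ_sum_of_nonneg fun i => hk.pow_nonneg _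
  by_cases h : i = ⟨1, hs⟩
  · have h0 : lam ⟨1, hs⟩ ^ k ≤ lam ⟨0, by omega⟩ ^ k := by
      rw [← hk.pow_abs, ← hk.pow_abs (lam ⟨0, _⟩)]
      exact pow_le_pow_left₀ (abs_nonneg _) (hlam.2 (Fin.mk_le_mk.2 zero_le_one)) k
    have := hpair ⟨1, hs⟩ ⟨0, by omega⟩ (by simp)
    rw [← h, hi, one_pow] at this h0 ⊢
    linarith
  · simpa [hi] using hpair i ⟨1, hs⟩ h

theorem pow_mul_trace_pow_transitionMatrix (hd0 : 0 < d) (k : ℕ) :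
    ((Matrix.diagonal π * M) ^ k).trace = d ^ k * (transitionMatrix M π d ^ k).trace := by
  rw [transitionMatrix, smul_pow, Matrix.trace_smul, smul_eq_mul, one_div, inv_pow,
    mul_inv_cancel_left₀ (pow_ne_zero _ hd0.ne')]

theorem trace_pow_diagonal_mul_const (hπ : π ∈ stdSimplex ℝ (Fin s)) {k : ℕ} (hk : k ≠ 0) :
    ((Matrix.diagonal π * Matrix.of fun _ _ => d) ^ k).trace = d ^ k := by
  obtain ⟨m, rfl⟩ := Nat.exists_eq_succ_of_ne_zero hk
  rw [Nat.succ_eq_add_one, trace_pow_eq_sum]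
  simp only [Matrix.diagonal_mul, Matrix.of_apply, Finset.prod_mul_distrib, Finset.prod_const,
    Finset.card_univ, Fintype.card_fin]
  rw [← Finset.sum_mul, sum_prod_eq_one hπ, one_mul]

/-! ### Chebyshev bounds and the choice of the threshold. -/

theorem eventually_le_blockModel_threshold (hM : M.IsSymm)
    (hM0 : ∀ i j, 0 ≤ M i j) (hπ : π ∈ stdSimplex ℝ (Fin s)) (hd0 : 0 < d)
    (hd : ∀ i, ∑ j, M i j * π j = d) {C : ℝ} (hC : 0 < C) {k : ℕ} (hk : 3 ≤ k)
    (htr : 1 ≤ (transitionMatrix M π d ^ k).trace) :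
    ∀ᶠ n : ℕ in atTop, 1 - s / C ^ 2 ≤ (blockModel n M π).real
      {G | cycleThreshold (transitionMatrix M π d) d C k ≤ (cycleCount k G : ℝ)} := by
  classical
  have hk0 : (0 : ℝ) < k := by exact_mod_cast (by omega : 0 < k)
  set μ := d ^ k * (transitionMatrix M π d ^ k).trace / (2 * k) with hμ
  have hμ0 : 0 < μ := by positivity
  set δ := C * √(d ^ k / k) with hδ
  have hδ0 : 0 < δ := by positivity
  have hμ' : μ = ((Matrix.diagonal π * M) ^ k).trace / (2 * k) := by
    rw [pow_mul_trace_pow_transitionMatrix hd0]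
  -- The slack is taken to be `μ` itself, so the mean square deviation is at most $2\mu \le
  -- s\,d^k/k$.
  filter_upwards [eventually_expect_cycleCount_sub_sq_le hM hM0 hπ hk hμ' hμ0] with n hn
  have ht : cycleThreshold (transitionMatrix M π d) d C k = μ - δ := rfl
  rw [blockModel_real n M hπ.1, ht]
  have hcheb := blockModel_expect_le_of_sq n M hπ.1 (fun G => (cycleCount k G : ℝ)) μ δ hδ0
    (fun G => ¬ μ - δ ≤ (cycleCount k G : ℝ)) fun G hG => by
      rw [abs_of_nonpos (by linarith)]
      linarith
  have hsum : expect n M π (fun G => if μ - δ ≤ (cycleCount k G : ℝ) then 1 else 0) +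
      expect n M π (fun G => if ¬ μ - δ ≤ (cycleCount k G : ℝ) then 1 else 0) = 1 := by
    rw [← expect_add]
    refine Eq.trans ?_ (expect_one n M hπ)
    congr 1
    funext G
    split_ifs <;> norm_num
  have hbound : expect n M π (fun G => ((cycleCount k G : ℝ) - μ) ^ 2) / δ ^ 2 ≤ s / C ^ 2 := by
    have h1 : δ ^ 2 = C ^ 2 * (d ^ k / k) := by
      rw [hδ, mul_pow, Real.sq_sqrt (by positivity)]
    have h2 : μ + μ = (transitionMatrix M π d ^ k).trace * (d ^ k / k) := by
      rw [hμ]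
      field_simp
      ring
    rw [div_le_div_iff₀ (by positivity) (by positivity)]
    calc _ ≤ (μ + μ) * C ^ 2 := by gcongr
      _ ≤ s * (d ^ k / k) * C ^ 2 := by
        rw [h2]
        gcongr
        exact trace_pow_transitionMatrix_le hM hM0 hπ.1 hd0 hd k
      _ = _ := by rw [h1]; ring
  simp only [Set.mem_ofPred_eq]
  linarith

/-- `ht` places the threshold at least $C\sqrt{d^k/k}$ above the limiting Erdős–Rényi mean. -/
theorem eventually_erdosRenyi_threshold_le (hπ : π ∈ stdSimplex ℝ (Fin s)) (hd0 : 0 < d) {C : ℝ}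
    (hC : 0 < C) {k : ℕ} (hk : 3 ≤ k) {T : Matrix (Fin s) (Fin s) ℝ}
    (ht : d ^ k / (2 * k) + C * √(d ^ k / k) ≤ cycleThreshold T d C k) :
    ∀ᶠ n : ℕ in atTop, (erdosRenyi n d).real
      {G | cycleThreshold T d C k ≤ (cycleCount k G : ℝ)} ≤ 1 / C ^ 2 := by
  classical
  have hk0 : (0 : ℝ) < k := by exact_mod_cast (by omega : 0 < k)
  set μ := d ^ k / (2 * k) with hμ
  have hμ0 : 0 < μ := by positivity
  set δ := C * √(d ^ k / k) with hδ
  have hδ0 : 0 < δ := by positivity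
  have hμ' : μ = ((Matrix.diagonal π * Matrix.of fun _ _ => d) ^ k).trace / (2 * k) := by
    rw [trace_pow_diagonal_mul_const hπ (by omega)]
  filter_upwards [eventually_expect_cycleCount_sub_sq_le (M := Matrix.of fun _ _ => d)
    (Matrix.IsSymm.ext fun _ _ => rfl) (fun _ _ => hd0.le) hπ hk hμ' hμ0] with n hn
  rw [erdosRenyi_real n d hπ]
  refine (blockModel_expect_le_of_sq n _ hπ.1 (fun G => (cycleCount k G : ℝ)) μ δ hδ0 _
    fun G hG => ?_).trans ?_
  · have hG : cycleThreshold T d C k ≤ (cycleCount k G : ℝ) := hG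
    rw [abs_of_nonneg (by linarith)]
    linarith
  · have h1 : δ ^ 2 = C ^ 2 * (d ^ k / k) := by
      rw [hδ, mul_pow, Real.sq_sqrt (by positivity)]
    have h2 : μ + μ = d ^ k / k := by
      rw [hμ]
      field_simp
      ring
    rw [div_le_div_iff₀ (by positivity) (by positivity), one_mul, h1, ← h2, mul_comm (C ^ 2)]
    gcongr

theorem exists_threshold (hs : 2 ≤ s) (hM : M.IsSymm)
    (hM0 : ∀ i j, 0 ≤ M i j) (hπ : π ∈ stdSimplex ℝ (Fin s))
    (hd : ∀ i, ∑ j, M i j * π j = d) (hlam : IsEigenvalueList (transitionMatrix M π d) lam)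
    (hKS : 1 < d * lam ⟨1, hs⟩ ^ 2) {ε : ℝ} (hε : 0 < ε) :
    ∃ C : ℝ, 0 < C ∧ ∃ k₀ : ℕ, ∀ k : ℕ, k₀ ≤ k → Even k → ∀ᶠ n : ℕ in atTop,
      1 - ε ≤ (blockModel n M π).real
        {G | cycleThreshold (transitionMatrix M π d) d C k ≤ (cycleCount k G : ℝ)} ∧
      (erdosRenyi n d).real
        {G | cycleThreshold (transitionMatrix M π d) d C k ≤ (cycleCount k G : ℝ)} ≤ ε := by
  have hd0 : 0 < d := by
    by_contra h
    have := mul_nonpos_of_nonpos_of_nonneg (not_lt.1 h) (sq_nonneg (lam ⟨1, hs⟩))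
    linarith
  have hs1 : (1 : ℝ) ≤ s := by exact_mod_cast (by omega : 1 ≤ s)
  -- This constant makes the block model error $s/C^2$ equal to `ε`; the Erdős–Rényi error $1/C^2$
  -- is then no larger.
  have hC2 : √(s / ε) ^ 2 = s / ε := Real.sq_sqrt (by positivity)
  have hC : 0 < √(s / ε) := by positivity
  set C := √(s / ε) with hCdef
  have hlim := (tendsto_pow_const_div_const_pow_of_one_lt 1 hKS).const_mul (16 * C ^ 2)
  rw [mul_zero] at hlim
  obtain ⟨k₁, hk₁⟩ := eventually_atTop.1 (hlim.eventually_lt_const zero_lt_one)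
  refine ⟨C, hC, max k₁ 3, fun k hk hke => ?_⟩
  have hk3 : 3 ≤ k := (le_max_right _ _).trans hk
  have hk0 : (0 : ℝ) < k := by exact_mod_cast (by omega : 0 < k)
  have hgrow := hk₁ k ((le_max_left _ _).trans hk)
  rw [pow_one, mul_div_assoc', div_lt_one (by positivity)] at hgrow
  have htr := one_add_pow_le_trace_pow hs hM hπ.1 hd0 hd hlam hke
  have hlk : 0 ≤ lam ⟨1, hs⟩ ^ k := hke.pow_nonneg _
  -- Half the gap $d^k\lambda_2^k/(2k)$ must cover the deviation $C\sqrt{d^k/k}$, one half for each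
  -- law. Squared, this says $16C^2k \le (d\lambda_2^2)^k$, which holds for large $k$.
  have hmain : 4 * k * (C * √(d ^ k / k)) ≤ d ^ k * lam ⟨1, hs⟩ ^ k := by
    rw [← pow_le_pow_iff_left₀ (by positivity) (by positivity) two_ne_zero]
    calc (4 * k * (C * √(d ^ k / k))) ^ 2 = 16 * C ^ 2 * k * d ^ k := by
          have h : √(d ^ k / k) ^ 2 = d ^ k / k := Real.sq_sqrt (by positivity)
          rw [mul_pow, mul_pow C, h]
          field_simp
          ring
      _ ≤ (d * lam ⟨1, hs⟩ ^ 2) ^ k * d ^ k := by gcongr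
      _ = (d ^ k * lam ⟨1, hs⟩ ^ k) ^ 2 := by ring
  have ht : d ^ k / (2 * k) + C * √(d ^ k / k) ≤
      cycleThreshold (transitionMatrix M π d) d C k := by
    have h1 : d ^ k * (1 + lam ⟨1, hs⟩ ^ k) / (2 * k) ≤
        d ^ k * (transitionMatrix M π d ^ k).trace / (2 * k) := by gcongr
    have h2 : 2 * (C * √(d ^ k / k)) ≤ d ^ k * lam ⟨1, hs⟩ ^ k / (2 * k) := by
      rw [le_div_iff₀ (by positivity)]
      linarith
    have h3 : d ^ k * (1 + lam ⟨1, hs⟩ ^ k) / (2 * k) =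
        d ^ k / (2 * k) + d ^ k * lam ⟨1, hs⟩ ^ k / (2 * k) := by ring
    rw [cycleThreshold]
    linarith
  have hsC : s / C ^ 2 = ε := by
    rw [hC2]
    field_simp
  filter_upwards [eventually_le_blockModel_threshold hM hM0 hπ hd0 hd hC hk3 (by linarith),
    eventually_erdosRenyi_threshold_le hπ hd0 hC hk3 ht] with n h1 h2
  refine ⟨hsC ▸ h1, h2.trans ?_⟩
  rw [← hsC]
  gcongr

end

/-! ### Passage to growing cycle lengths, and the theorem. -/

/-- Diagonalisation: properties that hold eventually, each in its own time, hold along some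
slowly growing sequence. -/
theorem exists_tendsto_atTop_forall {p : ℕ → ℕ → Prop} (h : ∀ j, ∀ᶠ n in atTop, p j n) :
    ∃ φ : ℕ → ℕ, Tendsto φ atTop atTop ∧ ∀ᶠ n in atTop, p (φ n) n := by
  classical
  choose N hN using fun j => eventually_atTop.1 (h j)
  refine ⟨fun n => Nat.findGreatest (fun j => N j ≤ n) n, ?_, ?_⟩
  · refine tendsto_atTop.2 fun j => ?_
    filter_upwards [eventually_ge_atTop (max (N j) j)] with n hn
    exact Nat.le_findGreatest ((le_max_right _ _).trans hn) ((le_max_left _ _).trans hn)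
  -- `Nat.findGreatest` returns 0 when no index qualifies, so $n \ge N_0$ is needed for its value to
  -- satisfy the condition.
  · filter_upwards [eventually_ge_atTop (N 0)] with n hn
    exact hN _ n (Nat.findGreatest_spec (P := fun j => N j ≤ n) (Nat.zero_le n) hn)

theorem blockModel_real_le_one {s n : ℕ} {M : Matrix (Fin s) (Fin s) ℝ} {π : Fin s → ℝ}
    (hπ : π ∈ stdSimplex ℝ (Fin s)) (S : Set (SimpleGraph (Fin n))) :
    (blockModel n M π).real S ≤ 1 := by
  classical
  rw [blockModel_real n M hπ.1]
  refine le_of_le_of_eq ?_ (expect_one n M hπ)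
  exact expect_mono M hπ.1 fun G => by split_ifs <;> norm_num

end BlockModel

theorem mainTheorem6 (s : ℕ) (hs : 2 ≤ s) (M : Matrix (Fin s) (Fin s) ℝ) (π : Fin s → ℝ) (d : ℝ)
    (hMsymm : M.IsSymm) (hMnonneg : ∀ i j, 0 ≤ M i j)
    (hπ : π ∈ stdSimplex ℝ (Fin s))
    (hd : ∀ i, ∑ j, M i j * π j = d)
    (lam : Fin s → ℝ)
    (hlam : BlockModel.IsEigenvalueList (BlockModel.transitionMatrix M π d) lam)
    (hKS : 1 < d * lam ⟨1, hs⟩ ^ 2) :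
    -- asymptotic orthogonality
    BlockModel.AsymptoticallyOrthogonal
      (fun n => BlockModel.blockModel n M π) (fun n => BlockModel.erdosRenyi n d) ∧
    -- the separating events are thresholds on the number of `k`-cycles, with `k` tending to infinity
    (∃ (k : ℕ → ℕ) (t : ℕ → ℝ), Tendsto k atTop atTop ∧
      Tendsto (fun n => (BlockModel.blockModel n M π).real
        {G | t n ≤ (BlockModel.cycleCount (k n) G : ℝ)}) atTop (𝓝 1) ∧
      Tendsto (fun n => (BlockModel.erdosRenyi n d).real
        {G | t n ≤ (BlockModel.cycleCount (k n) G : ℝ)}) atTop (𝓝 0)) ∧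
    -- the location of the threshold, for each large even `k`
    (∀ ε : ℝ, 0 < ε → ∃ C : ℝ, 0 < C ∧ ∃ k₀ : ℕ, ∀ k : ℕ, k₀ ≤ k → Even k →
      ∀ᶠ n : ℕ in atTop,
        1 - ε ≤ (BlockModel.blockModel n M π).real
          {G | BlockModel.cycleThreshold (BlockModel.transitionMatrix M π d) d C k
            ≤ (BlockModel.cycleCount k G : ℝ)} ∧
        (BlockModel.erdosRenyi n d).real
          {G | BlockModel.cycleThreshold (BlockModel.transitionMatrix M π d) d C k
            ≤ (BlockModel.cycleCount k G : ℝ)} ≤ ε) := by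
  have h3 := fun (ε : ℝ) (hε : 0 < ε) =>
    BlockModel.exists_threshold hs hMsymm hMnonneg hπ hd hlam hKS hε
  have h2 : ∃ (k : ℕ → ℕ) (t : ℕ → ℝ), Tendsto k atTop atTop ∧
      Tendsto (fun n => (BlockModel.blockModel n M π).real
        {G | t n ≤ (BlockModel.cycleCount (k n) G : ℝ)}) atTop (𝓝 1) ∧
      Tendsto (fun n => (BlockModel.erdosRenyi n d).real
        {G | t n ≤ (BlockModel.cycleCount (k n) G : ℝ)}) atTop (𝓝 0) := by
    -- The error $1/(j+1)$ is attached to the cycle length $2(k_0(j) + j)$, which is even, at least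
    -- $k_0(j)$, and tends to infinity with $j$.
    choose C _ k₀ hk₀ using fun j : ℕ => h3 (1 / ((j : ℝ) + 1)) Nat.one_div_pos_of_nat
    obtain ⟨φ, hφ, hφp⟩ := BlockModel.exists_tendsto_atTop_forall fun j =>
      hk₀ j (2 * (k₀ j + j)) (by omega) (even_two_mul _)
    have hlim : Tendsto (fun n => 1 / ((φ n : ℝ) + 1)) atTop (𝓝 0) :=
      tendsto_one_div_add_atTop_nhds_zero_nat.comp hφ
    refine ⟨fun n => 2 * (k₀ (φ n) + φ n), fun n => BlockModel.cycleThreshold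
      (BlockModel.transitionMatrix M π d) d (C (φ n)) (2 * (k₀ (φ n) + φ n)), ?_, ?_, ?_⟩
    · exact tendsto_atTop_mono (fun n => by omega) hφ
    · have hlim1 : Tendsto (fun n => 1 - 1 / ((φ n : ℝ) + 1)) atTop (𝓝 1) := by
        simpa using hlim.const_sub 1
      refine tendsto_of_tendsto_of_tendsto_of_le_of_le' hlim1 tendsto_const_nhds ?_ ?_
      · filter_upwards [hφp] with n hn using hn.1
      · exact Eventually.of_forall fun n => BlockModel.blockModel_real_le_one hπ _
    · refine tendsto_of_tendsto_of_tendsto_of_le_of_le' tendsto_const_nhds hlim ?_ ?_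
      · exact Eventually.of_forall fun n => measureReal_nonneg
      · filter_upwards [hφp] with n hn using hn.2
  refine ⟨?_, h2, h3⟩
  obtain ⟨k, t, -, hP, hQ⟩ := h2
  exact ⟨fun n => {G | t n ≤ (BlockModel.cycleCount (k n) G : ℝ)}, hP, hQ⟩
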